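/- Consider the plant $\dot z=Az+B\psi(Sz)+Nw$, $y=Cz+\eta$, with $z\in\mathbb R^{n_z}$, $y,\eta\in\mathbb R^{n_y}$, $w\in\mathbb R^{n_w}$, where $\psi:\mathbb R^{n_q}\to\mathbb R^{n_s}$ is Lipschitz with constant $\ell>0$. The output is available only at times $t_k$ with $0\le t_1\le T_2$ and $T_1\le t_{k+1}-t_k\le T_2$ for $k\ge1$, where $0<T_1\le T_2$. For gains $L\in\mathbb R^{n_z\times n_y}$, $H\in\mathbb R^{n_y\times n_y}$ consider the observer $\dot{\hat z}=A\hat z+B\psi(S\hat z)+L\theta$, $\dot\theta=H\theta$ for $t\ne t_k$, and $\hat z^+=\hat z$, $\theta^+=y-C\hat z$ at $t=t_k$. With $\varepsilon=z-\hat z$, $\tilde\theta=C(z-\hat z)-\theta$, $\zeta=\psi(Sz)-\psi(S(z-\varepsilon))$ and a timer $\tau$, the interconnection is the hybrid system $\mathcal H_e$ with state $x=(z,\varepsilon,\tilde\theta,\tau)$ and input $u=(w,\eta)$: if $\tau\in[0,T_2]$ it flows by $$\dot z=Az+B\psi(Sz)+Nw,\quad \dot\varepsilon=(A-LC)\varepsilon+L\tilde\theta+B\zeta+Nw,$$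 $$\dot{\tilde\theta}=(CA-CLC-HC)\varepsilon+(CL+H)\tilde\theta+CB\zeta+CNw,\quad \dot\tau=-1,$$ and if $\tau=0$ it jumps by $z^+=z$, $\varepsilon^+=\varepsilon$, $\tilde\theta^+=-\eta$, $\tau^+\in[T_1,T_2]$. Solution pairs $(\phi,u)$ are defined on hybrid time domains, with locally absolutely continuous hybrid arcs $\phi$ and measurable, locally essentially bounded hybrid inputs $u$. Let $y_p=C_p\varepsilon$ be the performance output and $\mathcal A=\mathbb R^{n_z}\times\{0\}\times\{0\}\times[0,T_2]$. Write $\operatorname{He}(M)=M+M^{\mathsf T}$. Let $\lambda_t,\gamma>0$ be given. Suppose that there are symmetric positive definite $P_1\in\mathbb R^{n_z\times n_z}$, $P_2\in\mathbb R^{n_y\times n_y}$, real numbers $\delta,\chi>0$, and matrices $X\in\mathbb R^{n_z\times n_z}$, $U,W\in\mathbb R^{n_y\times n_y}$, $J\in\mathbb R^{n_z\times n_y}$ such that for both $e=1$ and $e=e^{\delta T_2}$ the symmetric matrix $$\begin{pmatrix}\operatorname{He}(Z_1)&Z_2+\mathcal P_e&Z_3&Z_4\\ \bullet&\mathcal N_e+\operatorname{He}(Z_5)&Z_3&Z_4\\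 \bullet&\bullet&-\gamma^2I&0\\ \bullet&\bullet&\bullet&-\chi I\end{pmatrix}$$ is negative definite, where $\mathcal P_e=\operatorname{diag}\{P_1,eP_2\}$, $\mathcal N_e=\operatorname{diag}\{2\lambda_tP_1+C_p^{\mathsf T}C_p+\chi\ell^2S^{\mathsf T}S,\ (-\delta+2\lambda_t)eP_2\}$, $$Z_1=\begin{pmatrix}-X&C^{\mathsf T}U\\0&-U\end{pmatrix},\quad Z_2=\begin{pmatrix}-X+X^{\mathsf T}A-JC&J\\-WC&W\end{pmatrix},$$ $$Z_3=\begin{pmatrix}X^{\mathsf T}N\\0\end{pmatrix},\quad Z_4=\begin{pmatrix}X^{\mathsf T}B\\0\end{pmatrix},\quad Z_5=\begin{pmatrix}A^{\mathsf T}X-C^{\mathsf T}J^{\mathsf T}&0\\J^{\mathsf T}&0\end{pmatrix}.$$ Then $X$ and $U$ are invertible, and with the gains $L=X^{-\mathsf T}J$ and $H=U^{-\mathsf T}W$ the following hold. (P1) $\mathcal A$ is globally exponentially stable for $\mathcal H_e$ with zero input, with convergence rate $\lambda_t$ in ordinary time: there are $\kappa,\lambda>0$ such that every solution $\phi$ with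 $w\equiv0$, $\eta\equiv0$ satisfies $|\phi(t,j)|_{\mathcal A}\le\kappa e^{-\lambda_tt}|\phi(0,0)|_{\mathcal A}$ and $|\phi(t,j)|_{\mathcal A}\le\kappa e^{-\lambda(t+j)}|\phi(0,0)|_{\mathcal A}$ for all $(t,j)\in\operatorname{dom}\phi$, and every maximal such solution is complete. (P2) $\mathcal H_e$ is exponentially input-to-state stable with respect to $\mathcal A$, so that the estimation error is bounded for bounded disturbances: there are $\kappa,\lambda>0$ and $\rho\in\mathcal K$ such that every solution pair $(\phi,u)$ with $\|u\|_\infty<\infty$ satisfies $|\phi(t,j)|_{\mathcal A}\le\max\{\kappa e^{-\lambda(t+j)}|\phi(0,0)|_{\mathcal A},\rho(\|u\|_\infty)\}$ for all $(t,j)\in\operatorname{dom}\phi$, and every maximal solution pair with $\|u\|_\infty<\infty$ is complete. (P3) The $\mathcal L_2$-gain from $w$ to $y_p$ is at most $\gamma$ when $\eta\equiv0$: there is $\alpha>0$ such that every solution pair with $\eta\equiv0$ satisfies $$\sqrt{\int_{\mathcal I}|y_p(s,j(s))|^2ds}\le\alpha|\phi(0,0)|_{\mathcal A}+\gamma\sqrt{\int_{\mathcal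 I}|w(s,j(s))|^2ds},$$ where $\mathcal I=\operatorname{dom}_t\phi$ is the set of ordinary times of $\operatorname{dom}\phi$ and $j(s)=\min\{j:(s,j)\in\operatorname{dom}\phi\}$. -/

import Mathlib

open Set MeasureTheory Matrix
open scoped ENNReal

noncomputable section

/-! ## Hybrid systems, hybrid time domains, solution pairs -/

/-- A hybrid system with state in `X` and input `u = (w, η) ∈ W × Y`:
`ẋ = flow x w` on `flowSet`, and `x⁺ ∈ jump x η` on `jumpSet`. -/
structure HybridSystem (X W Y : Type*) where
  flow : X → W → X
  flowSet : Set X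
  jump : X → Y → Set X
  jumpSet : Set X

/-- `{t | (t, j) ∈ E}`: the interval of times at which the jump counter equals `j`. -/
def timeSlice (E : Set (ℝ × ℕ)) (j : ℕ) : Set ℝ := {t | (t, j) ∈ E}

/-- Hybrid time domains: the union of an infinite sequence of intervals `[t j, t (j+1)] × {j}`, or
of a finite one, whose last interval may be `[t J, t (J+1)]`, `[t J, t (J+1))` or `[t J, ∞)`. -/
def IsHybridTimeDomain (E : Set (ℝ × ℕ)) : Prop :=
  ∃ t : ℕ → ℝ, t 0 = 0 ∧ Monotone t ∧
    ((∀ j, timeSlice E j = Icc (t j) (t (j + 1))) ∨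
      ∃ J : ℕ, (∀ j < J, timeSlice E j = Icc (t j) (t (j + 1))) ∧
        (timeSlice E J = Icc (t J) (t (J + 1)) ∨
          (t J < t (J + 1) ∧ timeSlice E J = Ico (t J) (t (J + 1))) ∨
          timeSlice E J = Ici (t J)) ∧
        ∀ j, J < j → timeSlice E j = ∅)

/-- The points `(t, j)` of the domain at which a jump occurs, i.e. `(t, j + 1)` is in the domain. -/
def jumpPoints (E : Set (ℝ × ℕ)) : Set (ℝ × ℕ) := {p | p ∈ E ∧ (p.1, p.2 + 1) ∈ E}

/-- `u` is a hybrid input on `E`: for each `j`, `u(·, j)` is (Lebesgue) measurable and locally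
essentially bounded. -/
def IsHybridInput {V : Type*} [NormedAddCommGroup V] (E : Set (ℝ × ℕ)) (u : ℝ → ℕ → V) : Prop :=
  ∀ j, AEStronglyMeasurable (fun t => u t j) (volume.restrict (timeSlice E j)) ∧
    ∀ K : Set ℝ, IsCompact K → K ⊆ timeSlice E j →
      ∃ M : ℝ, ∀ᵐ t ∂(volume.restrict K), ‖u t j‖ ≤ M

/-- `φ` is a hybrid arc on `E`: for each `j`, `φ(·, j)` is locally absolutely continuous. -/
def IsHybridArc {V : Type*} [NormedAddCommGroup V] (E : Set (ℝ × ℕ)) (φ : ℝ → ℕ → V) : Prop :=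
  ∀ j, ∀ a ∈ timeSlice E j, ∀ b ∈ timeSlice E j,
    AbsolutelyContinuousOnInterval (fun t => φ t j) a b

/-- `(φ, (w, η))` is a solution pair, with common domain `E`, to the hybrid system `Sys`. Signals
are represented by functions on `ℝ × ℕ`, of which only the values on `E` matter. -/
structure IsSolutionPair {X W Y : Type*} [NormedAddCommGroup X] [NormedSpace ℝ X]
    [NormedAddCommGroup W] [NormedAddCommGroup Y] (Sys : HybridSystem X W Y)
    (E : Set (ℝ × ℕ)) (φ : ℝ → ℕ → X) (w : ℝ → ℕ → W) (η : ℝ → ℕ → Y) : Prop where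
  timeDomain : IsHybridTimeDomain E
  arc : IsHybridArc E φ
  input_w : IsHybridInput E w
  input_η : IsHybridInput E η
  initial : φ 0 0 ∈ Sys.flowSet ∪ Sys.jumpSet
  flows : ∀ j, ∀ᵐ t ∂(volume.restrict (timeSlice E j)),
    φ t j ∈ Sys.flowSet ∧ HasDerivAt (fun s => φ s j) (Sys.flow (φ t j) (w t j)) t
  jumps : ∀ t j, (t, j) ∈ jumpPoints E →
    φ t j ∈ Sys.jumpSet ∧ φ t (j + 1) ∈ Sys.jump (φ t j) (η t j)

/-- The signal `u` vanishes identically on `E`. -/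
def ZeroOn {V : Type*} [Zero V] (E : Set (ℝ × ℕ)) (u : ℝ → ℕ → V) : Prop :=
  ∀ t j, (t, j) ∈ E → u t j = 0

/-- A domain is complete when it is unbounded. -/
def IsCompleteDomain (E : Set (ℝ × ℕ)) : Prop := ∀ M : ℝ, ∃ p ∈ E, M < p.1 + p.2

/-- A solution pair is maximal if it has no extension to a solution pair with larger domain. -/
def IsMaximalPair {X W Y : Type*} [NormedAddCommGroup X] [NormedSpace ℝ X]
    [NormedAddCommGroup W] [NormedAddCommGroup Y] (Sys : HybridSystem X W Y)
    (E : Set (ℝ × ℕ)) (φ : ℝ → ℕ → X) (w : ℝ → ℕ → W) (η : ℝ → ℕ → Y) : Prop :=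
  IsSolutionPair Sys E φ w η ∧
    ∀ E' φ' w' η', IsSolutionPair Sys E' φ' w' η' → E ⊆ E' →
      (∀ t j, (t, j) ∈ E → φ' t j = φ t j ∧ w' t j = w t j ∧ η' t j = η t j) → E' = E

/-- A solution with zero input is maximal (as such) if it has no extension to a solution with zero
input and larger domain. -/
def IsMaximalZeroInput {X W Y : Type*} [NormedAddCommGroup X] [NormedSpace ℝ X]
    [NormedAddCommGroup W] [NormedAddCommGroup Y] (Sys : HybridSystem X W Y)
    (E : Set (ℝ × ℕ)) (φ : ℝ → ℕ → X) : Prop :=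
  IsSolutionPair Sys E φ 0 0 ∧
    ∀ E' φ', IsSolutionPair Sys E' φ' 0 0 → E ⊆ E' →
      (∀ t j, (t, j) ∈ E → φ' t j = φ t j) → E' = E

/-- The `L∞` norm of a hybrid signal: the essential supremum along flows, and the supremum over the
points where jumps occur. -/
def linfNorm {V : Type*} [NormedAddCommGroup V] (E : Set (ℝ × ℕ)) (u : ℝ → ℕ → V) : ℝ≥0∞ :=
  max (⨆ j : ℕ, essSup (fun t => ‖u t j‖ₑ) (volume.restrict (timeSlice (E \ jumpPoints E) j)))
    (⨆ p ∈ jumpPoints E, ‖u p.1 p.2‖ₑ)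

/-- The input signal `u = (w, η)`, with the Euclidean norm `|u|² = |w|² + |η|²`. -/
def pairInput {W Y : Type*} (w : ℝ → ℕ → W) (η : ℝ → ℕ → Y) : ℝ → ℕ → WithLp 2 (W × Y) :=
  fun t j => WithLp.toLp 2 (w t j, η t j)

/-- Class `K` functions `[0, ∞) → [0, ∞)`. -/
def IsClassK (ρ : ℝ → ℝ) : Prop :=
  ContinuousOn ρ (Ici 0) ∧ StrictMonoOn ρ (Ici 0) ∧ ρ 0 = 0

/-- Exponential input-to-state stability with respect to `𝒜`: the estimate holds along every
solution pair with input in `L∞`, and the maximal ones among these are complete. -/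
def IsEISS {X W Y : Type*} [NormedAddCommGroup X] [NormedSpace ℝ X]
    [NormedAddCommGroup W] [NormedAddCommGroup Y] (Sys : HybridSystem X W Y) (𝒜 : Set X) : Prop :=
  (∃ κ > 0, ∃ rate > 0, ∃ ρ : ℝ → ℝ, IsClassK ρ ∧
    ∀ E φ w η, IsSolutionPair Sys E φ w η → linfNorm E (pairInput w η) < ∞ →
      ∀ t j, (t, j) ∈ E →
        Metric.infDist (φ t j) 𝒜 ≤
          max (κ * Real.exp (-rate * (t + j)) * Metric.infDist (φ 0 0) 𝒜)
            (ρ (linfNorm E (pairInput w η)).toReal)) ∧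
  ∀ E φ w η, IsMaximalPair Sys E φ w η → linfNorm E (pairInput w η) < ∞ → IsCompleteDomain E

/-- Global exponential stability of `𝒜` under zero input, with convergence rate `lam` with respect
to ordinary time; maximal solutions are complete. -/
def IsGESWithRate {X W Y : Type*} [NormedAddCommGroup X] [NormedSpace ℝ X]
    [NormedAddCommGroup W] [NormedAddCommGroup Y] (Sys : HybridSystem X W Y) (𝒜 : Set X)
    (lam : ℝ) : Prop :=
  (∃ κ > 0, ∃ rate > 0, ∀ E φ w η, IsSolutionPair Sys E φ w η → ZeroOn E w → ZeroOn E η →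
    ∀ t j, (t, j) ∈ E →
      Metric.infDist (φ t j) 𝒜 ≤ κ * Real.exp (-lam * t) * Metric.infDist (φ 0 0) 𝒜 ∧
      Metric.infDist (φ t j) 𝒜 ≤ κ * Real.exp (-rate * (t + j)) * Metric.infDist (φ 0 0) 𝒜) ∧
  ∀ E φ, IsMaximalZeroInput Sys E φ → IsCompleteDomain E

/-- `dom_t`: the ordinary times occurring in the hybrid time domain. -/
def ordinaryTimes (E : Set (ℝ × ℕ)) : Set ℝ := {t | ∃ j, (t, j) ∈ E}

/-- The smallest jump counter at ordinary time `t`. -/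
def firstCounter (E : Set (ℝ × ℕ)) (t : ℝ) : ℕ := sInf {j | (t, j) ∈ E}

/-- The `L²` norm over ordinary time of a hybrid signal, in `[0, ∞]`. -/
def l2Norm {V : Type*} [NormedAddCommGroup V] (E : Set (ℝ × ℕ)) (u : ℝ → ℕ → V) : ℝ≥0∞ :=
  eLpNorm (fun s => u s (firstCounter E s)) 2 (volume.restrict (ordinaryTimes E))

/-- `L²`-external stability, with gain `γ`, from `w` to the output `h(x)` when `η ≡ 0`. -/
def HasL2Gain {X W Y V : Type*} [NormedAddCommGroup X] [NormedSpace ℝ X]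
    [NormedAddCommGroup W] [NormedAddCommGroup Y] [NormedAddCommGroup V]
    (Sys : HybridSystem X W Y) (𝒜 : Set X) (h : X → V) (γ : ℝ) : Prop :=
  ∃ α > 0, ∀ E φ w η, IsSolutionPair Sys E φ w η → ZeroOn E η →
    l2Norm E (fun t j => h (φ t j)) ≤
      ENNReal.ofReal (α * Metric.infDist (φ 0 0) 𝒜) + ENNReal.ofReal γ * l2Norm E w

/-! ## The plant, the observer, and the hybrid model of their interconnection -/

/-- Euclidean space `ℝⁿ`. -/
abbrev Vec (n : ℕ) := EuclideanSpace ℝ (Fin n)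

/-- The plant `ż = A z + B ψ(S z) + N w`, `y = C z + η`, with performance output
`y_p = Cp (z - ẑ)`. -/
structure Plant (nz ny nw nq ns np : ℕ) where
  A : Matrix (Fin nz) (Fin nz) ℝ
  B : Matrix (Fin nz) (Fin ns) ℝ
  C : Matrix (Fin ny) (Fin nz) ℝ
  N : Matrix (Fin nz) (Fin nw) ℝ
  S : Matrix (Fin nq) (Fin nz) ℝ
  Cp : Matrix (Fin np) (Fin nz) ℝ
  ψ : Vec nq → Vec ns

/-- The state space `ℝ^(nz + (nz + ny) + 1)`, whose elements are `x = (z, (ε, θ̃), τ)`. -/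
abbrev HState (nz ny : ℕ) := EuclideanSpace ℝ (Fin nz ⊕ ((Fin nz ⊕ Fin ny) ⊕ Unit))

namespace HState

variable {nz ny : ℕ}

/-- The vector `(z, e, τ)`, where `e = (ε, θ̃)`. -/
def mk (z : Fin nz → ℝ) (e : Fin nz ⊕ Fin ny → ℝ) (τ : ℝ) : HState nz ny :=
  WithLp.toLp 2 (Sum.elim z (Sum.elim e fun _ => τ))

/-- The plant state `z`. -/
def z (x : HState nz ny) : Fin nz → ℝ := fun i => x (Sum.inl i)

/-- The pair `(ε, θ̃)`. -/
def err (x : HState nz ny) : Fin nz ⊕ Fin ny → ℝ := fun i => x (Sum.inr (Sum.inl i))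

/-- The estimation error `ε = z - ẑ`. -/
def ε (x : HState nz ny) : Fin nz → ℝ := fun i => x.err (Sum.inl i)

/-- The timer `τ`. -/
def τ (x : HState nz ny) : ℝ := x (Sum.inr (Sum.inr ()))

end HState

namespace Plant

variable {nz ny nw nq ns np : ℕ}

/-- `ψ(S v)`. -/
def nonlin (P : Plant nz ny nw nq ns np) (v : Fin nz → ℝ) : Fin ns → ℝ :=
  (P.ψ (WithLp.toLp 2 (P.S *ᵥ v))).ofLp

/-- `ζ(v₁, v₂) = ψ(S v₁) - ψ(S (v₁ - v₂))`. -/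
def zeta (P : Plant nz ny nw nq ns np) (v₁ v₂ : Fin nz → ℝ) : Fin ns → ℝ :=
  P.nonlin v₁ - P.nonlin (v₁ - v₂)

/-- The right-hand side `A z + B ψ(S z) + N w` of the plant. -/
def plantField (P : Plant nz ny nw nq ns np) (z : Fin nz → ℝ) (w : Fin nw → ℝ) : Fin nz → ℝ :=
  P.A *ᵥ z + P.B *ᵥ P.nonlin z + P.N *ᵥ w

/-- The matrix `𝓕` of the error dynamics for the observer gains `L`, `H`. -/
def calF (P : Plant nz ny nw nq ns np) (L : Matrix (Fin nz) (Fin ny) ℝ)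
    (H : Matrix (Fin ny) (Fin ny) ℝ) : Matrix (Fin nz ⊕ Fin ny) (Fin nz ⊕ Fin ny) ℝ :=
  fromBlocks (P.A - L * P.C) L (P.C * P.A - P.C * L * P.C - H * P.C) (P.C * L + H)

/-- The matrix `𝓠 = (B; C B)`. -/
def calQ (P : Plant nz ny nw nq ns np) : Matrix (Fin nz ⊕ Fin ny) (Fin ns) ℝ :=
  fromRows P.B (P.C * P.B)

/-- The matrix `𝓣 = (N; C N)`. -/
def calT (P : Plant nz ny nw nq ns np) : Matrix (Fin nz ⊕ Fin ny) (Fin nw) ℝ :=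
  fromRows P.N (P.C * P.N)

/-- The matrix `𝓖 = diag(I, 0)`. -/
def calG (nz ny : ℕ) : Matrix (Fin nz ⊕ Fin ny) (Fin nz ⊕ Fin ny) ℝ :=
  fromBlocks 1 0 0 0

/-- The matrix `𝓝 = (0; -I)`. -/
def calN (nz ny : ℕ) : Matrix (Fin nz ⊕ Fin ny) (Fin ny) ℝ :=
  fromRows 0 (-1)

/-- The hybrid model of the plant interconnected with the observer with gains `L`, `H`
(`ẑ' = A ẑ + B ψ(S ẑ) + L θ`, `θ' = H θ` between samples; `θ⁺ = y - C ẑ` at samples), with sampling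
intervals in `[T₁, T₂]`, in the coordinates `z`, `ε = z - ẑ`, `θ̃ = C (z - ẑ) - θ`, `τ`. -/
def errorSystem (P : Plant nz ny nw nq ns np) (L : Matrix (Fin nz) (Fin ny) ℝ)
    (H : Matrix (Fin ny) (Fin ny) ℝ) (T₁ T₂ : ℝ) :
    HybridSystem (HState nz ny) (Vec nw) (Vec ny) where
  flow x w := HState.mk (P.plantField x.z w.ofLp)
    (P.calF L H *ᵥ x.err + P.calQ *ᵥ P.zeta x.z x.ε + P.calT *ᵥ w.ofLp) (-1)
  flowSet := {x | x.τ ∈ Icc 0 T₂}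
  jump x η := {g | ∃ v ∈ Icc T₁ T₂,
    g = HState.mk x.z (calG nz ny *ᵥ x.err + calN nz ny *ᵥ η.ofLp) v}
  jumpSet := {x | x.τ = 0}

/-- The set `ℝ^nz × {0} × {0} × [0, T₂]`. -/
def attractor (nz ny : ℕ) (T₂ : ℝ) : Set (HState nz ny) := {x | x.err = 0 ∧ x.τ ∈ Icc 0 T₂}

/-- The performance output `y_p = Cp ε`. -/
def perfOutput (P : Plant nz ny nw nq ns np) (x : HState nz ny) : Vec np :=
  WithLp.toLp 2 (P.Cp *ᵥ x.ε)

/-- The observer with gains `L`, `H` solves the estimation problem: exponential stability with rate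
`lam` without disturbances, bounded error (in the input-to-state sense) under bounded disturbances,
and `L²`-gain at most `γ` from `w` to `y_p` without measurement noise. -/
def ObserverSolves (P : Plant nz ny nw nq ns np) (T₁ T₂ lam γ : ℝ)
    (L : Matrix (Fin nz) (Fin ny) ℝ) (H : Matrix (Fin ny) (Fin ny) ℝ) : Prop :=
  IsGESWithRate (P.errorSystem L H T₁ T₂) (attractor nz ny T₂) lam ∧
  IsEISS (P.errorSystem L H T₁ T₂) (attractor nz ny T₂) ∧
  HasL2Gain (P.errorSystem L H T₁ T₂) (attractor nz ny T₂) P.perfOutput γ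

/-! ### The error coordinates -/

/-- The right-hand side `A ẑ + B ψ(S ẑ) + L θ` of the observer. -/
def observerField (P : Plant nz ny nw nq ns np) (L : Matrix (Fin nz) (Fin ny) ℝ)
    (zh : Fin nz → ℝ) (θ : Fin ny → ℝ) : Fin nz → ℝ :=
  P.A *ᵥ zh + P.B *ᵥ P.nonlin zh + L *ᵥ θ

/-- The linear change of coordinates `(z, ẑ, θ, τ) ↦ (z, z - ẑ, C (z - ẑ) - θ, τ)`. -/
def toError (P : Plant nz ny nw nq ns np) (z zh : Fin nz → ℝ) (θ : Fin ny → ℝ) (τ : ℝ) :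
    HState nz ny :=
  HState.mk z (Sum.elim (z - zh) (P.C *ᵥ (z - zh) - θ)) τ

/-- In error coordinates, the flow of plant, observer and timer is the flow map above. -/
theorem errorSystem_flow_toError (P : Plant nz ny nw nq ns np) (L : Matrix (Fin nz) (Fin ny) ℝ)
    (H : Matrix (Fin ny) (Fin ny) ℝ) (T₁ T₂ : ℝ) (z zh : Fin nz → ℝ) (θ : Fin ny → ℝ) (τ : ℝ)
    (w : Vec nw) :
    (P.errorSystem L H T₁ T₂).flow (P.toError z zh θ τ) w =
      P.toError (P.plantField z w.ofLp) (P.observerField L zh θ) (H *ᵥ θ) (-1) := by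
  have h1 : (P.toError z zh θ τ).z = z := rfl
  have h2 : (P.toError z zh θ τ).err = Sum.elim (z - zh) (P.C *ᵥ (z - zh) - θ) := rfl
  have h3 : (P.toError z zh θ τ).ε = z - zh := rfl
  simp only [errorSystem, h1, h2, h3]
  unfold toError
  congr 1
  simp only [calF, calQ, calT, zeta, plantField, observerField, fromBlocks_mulVec,
    fromRows_mulVec, sub_sub_cancel, Sum.elim_comp_inl, Sum.elim_comp_inr]
  ext i
  rcases i with i | i <;>
    simp [Matrix.sub_mulVec, Matrix.add_mulVec, Matrix.mulVec_sub, Matrix.mulVec_add,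
      ← Matrix.mulVec_mulVec] <;> ring

/-- In error coordinates, resetting `θ` to `y - C ẑ`, with `y = C z + η`, is the jump map above. -/
theorem errorSystem_jump_toError (P : Plant nz ny nw nq ns np) (L : Matrix (Fin nz) (Fin ny) ℝ)
    (H : Matrix (Fin ny) (Fin ny) ℝ) (T₁ T₂ : ℝ) (z zh : Fin nz → ℝ) (θ : Fin ny → ℝ) (τ : ℝ)
    (η : Vec ny) :
    (P.errorSystem L H T₁ T₂).jump (P.toError z zh θ τ) η =
      {g | ∃ v ∈ Icc T₁ T₂, g = P.toError z zh ((P.C *ᵥ z + η.ofLp) - P.C *ᵥ zh) v} := by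
  have h1 : (P.toError z zh θ τ).z = z := rfl
  have h2 : (P.toError z zh θ τ).err = Sum.elim (z - zh) (P.C *ᵥ (z - zh) - θ) := rfl
  have h3 : calG nz ny *ᵥ Sum.elim (z - zh) (P.C *ᵥ (z - zh) - θ) + calN nz ny *ᵥ η.ofLp =
      Sum.elim (z - zh) (P.C *ᵥ (z - zh) - (P.C *ᵥ z + η.ofLp - P.C *ᵥ zh)) := by
    ext i
    rcases i with i | i <;>
      simp [calG, calN, fromBlocks_mulVec, fromRows_mulVec, Matrix.mulVec_sub, Matrix.neg_mulVec]
  simp only [errorSystem, h1, h2, h3]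
  rfl

/-! ## The linear matrix inequalities -/

/-- `He(M) = M + Mᵀ`. -/
def he {n : Type*} (M : Matrix n n ℝ) : Matrix n n ℝ := M + Mᵀ

/-- The symmetric block matrix of the design inequalities, with `e = 1` in the first of them and
`e = exp(δ T₂)` in the second. -/
def designMatrix (P : Plant nz ny nw nq ns np) (ℓ lam γ δ χ e : ℝ)
    (P₁ X : Matrix (Fin nz) (Fin nz) ℝ) (P₂ U W : Matrix (Fin ny) (Fin ny) ℝ)
    (J : Matrix (Fin nz) (Fin ny) ℝ) :
    Matrix (((Fin nz ⊕ Fin ny) ⊕ (Fin nz ⊕ Fin ny)) ⊕ (Fin nw ⊕ Fin ns))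
      (((Fin nz ⊕ Fin ny) ⊕ (Fin nz ⊕ Fin ny)) ⊕ (Fin nw ⊕ Fin ns)) ℝ :=
  let calP : Matrix (Fin nz ⊕ Fin ny) (Fin nz ⊕ Fin ny) ℝ := fromBlocks P₁ 0 0 (e • P₂)
  let calM : Matrix (Fin nz ⊕ Fin ny) (Fin nz ⊕ Fin ny) ℝ :=
    fromBlocks ((2 * lam) • P₁ + P.Cpᵀ * P.Cp + (χ * ℓ ^ 2) • (P.Sᵀ * P.S)) 0
      0 (((-δ + 2 * lam) * e) • P₂)
  let Z₁ : Matrix (Fin nz ⊕ Fin ny) (Fin nz ⊕ Fin ny) ℝ := fromBlocks (-X) (P.Cᵀ * U) 0 (-U)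
  let Z₂ : Matrix (Fin nz ⊕ Fin ny) (Fin nz ⊕ Fin ny) ℝ :=
    fromBlocks (-X + Xᵀ * P.A - J * P.C) J (-(W * P.C)) W
  let Z₃ : Matrix (Fin nz ⊕ Fin ny) (Fin nw) ℝ := fromRows (Xᵀ * P.N) 0
  let Z₄ : Matrix (Fin nz ⊕ Fin ny) (Fin ns) ℝ := fromRows (Xᵀ * P.B) 0
  let Z₅ : Matrix (Fin nz ⊕ Fin ny) (Fin nz ⊕ Fin ny) ℝ :=
    fromBlocks (P.Aᵀ * X - P.Cᵀ * Jᵀ) 0 Jᵀ 0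
  let Z₆ : Matrix (Fin nz ⊕ Fin ny) (Fin nw) ℝ := fromRows (Xᵀ * P.N) 0
  let Z₇ : Matrix (Fin nz ⊕ Fin ny) (Fin ns) ℝ := fromRows (Xᵀ * P.B) 0
  let upper := fromBlocks Z₃ Z₄ Z₆ Z₇
  fromBlocks (fromBlocks (he Z₁) (Z₂ + calP) (Z₂ + calP)ᵀ (calM + he Z₅)) upper
    upperᵀ (fromBlocks (-(γ ^ 2) • 1) 0 0 (-χ • 1))

/-- The design inequalities: both block matrices are negative definite. -/
def DesignLMI (P : Plant nz ny nw nq ns np) (ℓ T₂ lam γ δ χ : ℝ)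
    (P₁ X : Matrix (Fin nz) (Fin nz) ℝ) (P₂ U W : Matrix (Fin ny) (Fin ny) ℝ)
    (J : Matrix (Fin nz) (Fin ny) ℝ) : Prop :=
  (-(P.designMatrix ℓ lam γ δ χ 1 P₁ X P₂ U W J)).PosDef ∧
  (-(P.designMatrix ℓ lam γ δ χ (Real.exp (δ * T₂)) P₁ X P₂ U W J)).PosDef

end Plant

end

/-! ## Absolutely continuous functions -/

section AbsolutelyContinuous

/-! Everything rests on V(x) = εᵀP₁ε + e^{δτ} θ̃ᵀP₂θ̃. The matrix inequality is evaluated at (ε',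
θ̃', ε, θ̃, w, ζ), whose first two entries are velocities. X and U act as multipliers of the
equations of motion: with J = XᵀL and W = UᵀH, all terms in X, U, J, W assemble into products with
the residuals of ε' = Aε + L(θ̃ - Cε) + Bζ + Nw and θ̃' = Cε' + H(θ̃ - Cε), which vanish along
flows. The form is affine in e, so the two extreme values cover e = e^{δτ} for every τ in [0, T₂].
Since |ζ| ≤ ℓ|Sε|, the χ-term can be discarded, and V' ≤ -2λ_t V - |y_p|² + γ²|w|² remains
(`Plant.ae_dissipation`). Jumps happen at τ = 0, where the weight e^{δτ} is 1; they keep ε and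
replace θ̃ by -η, so V grows by at most p|η|² (`Plant.jump_lyap_le`).

For P1 and P2, Grönwall's inequality is used between jumps. Consecutive jumps are at least T₁ apart,
so their contributions form a convergent geometric series and V ≤ e^{-2λ_t t} V(0) + Dμ², where μ
bounds the inputs (`Plant.exists_lyap_le_exp`). The same separation bounds j by an affine function
of t, which turns decay in t into decay in t + j. P1 is the case μ = 0.

For P3, V does not increase at jumps when η = 0, so the integrated dissipation inequalities
telescope over the slices.

Completeness holds because a solution on a bounded domain with bounded inputs can be continued
(`Plant.exists_extension`): a closed last interval is followed by a jump if τ = 0 and by a flow with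
w = 0 if τ > 0, while a half-open one is closed, linear growth of the vector field excluding
blow-up. -/

theorem AbsolutelyContinuousOnInterval.comp_locallyLipschitz {X Y : Type*}
    [SeminormedAddCommGroup X] [PseudoMetricSpace Y] {f : ℝ → X} {g : X → Y} {a b : ℝ} (hg : LocallyLipschitz g)
    (hf : AbsolutelyContinuousOnInterval f a b) :
    AbsolutelyContinuousOnInterval (fun t => g (f t)) a b := by
  obtain ⟨K, hK⟩ := LocallyLipschitzOn.exists_lipschitzOnWith_of_compact
    (isCompact_uIcc.image_of_continuousOn hf.continuousOn)
    (hg.locallyLipschitzOn (s := f '' uIcc a b))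
  rw [absolutelyContinuousOnInterval_iff] at hf ⊢
  intro ε hε
  obtain ⟨d, hd, h⟩ := hf (ε / (K + 1)) (by positivity)
  refine ⟨d, hd, fun E hE hlt => ?_⟩
  calc ∑ i ∈ Finset.range E.1, dist (g (f (E.2 i).1)) (g (f (E.2 i).2))
      ≤ ∑ i ∈ Finset.range E.1, (K + 1 : ℝ) * dist (f (E.2 i).1) (f (E.2 i).2) := by
        refine Finset.sum_le_sum fun i hi => ?_
        refine (hK.dist_le_mul _ (mem_image_of_mem _ (hE.1 i hi).1) _
          (mem_image_of_mem _ (hE.1 i hi).2)).trans ?_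
        gcongr
        linarith
    _ = (K + 1) * ∑ i ∈ Finset.range E.1, dist (f (E.2 i).1) (f (E.2 i).2) := by
        rw [Finset.mul_sum]
    _ < ε := by
        have := h E hE hlt
        rwa [lt_div_iff₀ (by positivity), mul_comm] at this

theorem AbsolutelyContinuousOnInterval.congr {X : Type*} [PseudoMetricSpace X] {f g : ℝ → X}
    {a b : ℝ} (hf : AbsolutelyContinuousOnInterval f a b) (h : EqOn f g (uIcc a b)) :
    AbsolutelyContinuousOnInterval g a b := by
  rw [absolutelyContinuousOnInterval_iff] at hf ⊢
  intro ε hε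
  obtain ⟨d, hd, h'⟩ := hf ε hε
  refine ⟨d, hd, fun E hE hlt => ?_⟩
  convert h' E hE hlt using 2 with i hi
  rw [h (hE.1 i hi).1, h (hE.1 i hi).2]

/-- Freezing an absolutely continuous function after time `b`. -/
theorem AbsolutelyContinuousOnInterval.comp_min {X : Type*} [PseudoMetricSpace X] {f : ℝ → X}
    {a b c : ℝ} (hab : a ≤ b) (hbc : b ≤ c) (hf : AbsolutelyContinuousOnInterval f a b) :
    AbsolutelyContinuousOnInterval (fun t => f (min t b)) a c := by
  rw [absolutelyContinuousOnInterval_iff] at hf ⊢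
  intro ε hε
  obtain ⟨d, hd, h⟩ := hf ε hε
  refine ⟨d, hd, fun E hE hlt => ?_⟩
  refine h (E.1, fun i => (min (E.2 i).1 b, min (E.2 i).2 b)) ⟨fun i hi => ?_, ?_⟩ ?_
  · have := hE.1 i hi
    rw [uIcc_of_le (hab.trans hbc)] at this
    rw [uIcc_of_le hab]
    exact ⟨⟨le_min this.1.1 hab, min_le_right _ _⟩, ⟨le_min this.2.1 hab, min_le_right _ _⟩⟩
  -- Truncation at b shrinks each interval, so disjointness survives; being 1-Lipschitz, it does not
  -- increase the lengths either.
  · refine hE.2.mono fun i => ?_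
    intro z hz
    simp only [uIoc, mem_Ioc] at hz ⊢
    grind
  · refine lt_of_le_of_lt (Finset.sum_le_sum fun i _ => ?_) hlt
    simpa [Real.dist_eq] using abs_min_sub_min_le_max (E.2 i).1 b (E.2 i).2 b

/-- Concatenation of an absolutely continuous function and a Lipschitz one. -/
theorem AbsolutelyContinuousOnInterval.concat {X : Type*} [NormedAddCommGroup X] {f g : ℝ → X}
    {a b c : ℝ} (hab : a ≤ b) (hbc : b ≤ c) (hf : AbsolutelyContinuousOnInterval f a b)
    {K : NNReal} (hg : LipschitzOnWith K g (Icc b c)) (hfg : f b = g b) :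
    AbsolutelyContinuousOnInterval (fun t => if t ≤ b then f t else g t) a c := by
  have h1 := hf.comp_min hab hbc
  have h2 : AbsolutelyContinuousOnInterval (fun t => g (max t b)) a c := by
    refine LipschitzOnWith.absolutelyContinuousOnInterval (K := K) ?_
    rw [uIcc_of_le (hab.trans hbc)]
    refine LipschitzOnWith.of_dist_le_mul fun x hx y hy => ?_
    refine (hg.dist_le_mul _ ⟨le_max_right _ _, max_le hx.2 hbc⟩ _
      ⟨le_max_right _ _, max_le hy.2 hbc⟩).trans ?_
    gcongr
    simpa [Real.dist_eq] using abs_max_sub_max_le_max x b y b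
  have h3 : AbsolutelyContinuousOnInterval (fun _ => g b) a c :=
    LipschitzOnWith.absolutelyContinuousOnInterval (LipschitzWith.const (g b)).lipschitzOnWith
  -- The concatenation equals f(min t b) + g(max t b) - g(b).
  refine ((h1.add h2).sub h3).congr fun t _ => ?_
  simp only [Pi.add_apply, Pi.sub_apply]
  split_ifs with h
  · simp [h]
  · rw [min_eq_right (le_of_not_ge h), max_eq_left (le_of_not_ge h), hfg]; abel

theorem AbsolutelyContinuousOnInterval.sub_le_integral {f f' g : ℝ → ℝ} {a b : ℝ} (hab : a ≤ b)
    (hf : AbsolutelyContinuousOnInterval f a b)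
    (h : ∀ᵐ t ∂(volume.restrict (Icc a b)), HasDerivAt f (f' t) t ∧ f' t ≤ g t)
    (hg : IntervalIntegrable g volume a b) :
    f b - f a ≤ ∫ t in a..b, g t := by
  rw [← hf.integral_deriv_eq_sub]
  refine intervalIntegral.integral_mono_ae_restrict hab hf.intervalIntegrable_deriv hg ?_
  filter_upwards [h] with t ht
  rw [ht.1.deriv]
  exact ht.2

theorem AbsolutelyContinuousOnInterval.sub_le_mul {f f' : ℝ → ℝ} {a b M : ℝ} (hab : a ≤ b)
    (hf : AbsolutelyContinuousOnInterval f a b)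
    (h : ∀ᵐ t ∂(volume.restrict (Icc a b)), HasDerivAt f (f' t) t ∧ f' t ≤ M) :
    f b - f a ≤ M * (b - a) := by
  have := hf.sub_le_integral hab h (g := fun _ => M) intervalIntegrable_const
  rw [intervalIntegral.integral_const, smul_eq_mul] at this
  linarith

/-- Grönwall's inequality. -/
theorem AbsolutelyContinuousOnInterval.le_exp_mul_add {f f' : ℝ → ℝ} {a b c g : ℝ} (hab : a ≤ b)
    (hf : AbsolutelyContinuousOnInterval f a b)
    (h : ∀ᵐ t ∂(volume.restrict (Icc a b)), HasDerivAt f (f' t) t ∧ f' t ≤ -c * (f t - g)) :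
    f b ≤ Real.exp (-c * (b - a)) * (f a - g) + g := by
  have hexp : AbsolutelyContinuousOnInterval (fun t => Real.exp (c * (t - a))) a b :=
    ContDiffOn.absolutelyContinuousOnInterval (by fun_prop)
  have hconst : AbsolutelyContinuousOnInterval (fun _ : ℝ => g) a b :=
    LipschitzOnWith.absolutelyContinuousOnInterval (LipschitzWith.const g).lipschitzOnWith
  -- The function e^{c(t-a)}(f - g) has nonpositive derivative. No sign of c enters; a negative c is
  -- used later for exponential growth bounds.
  have key := (hexp.mul (hf.sub hconst)).sub_le_mul hab (M := 0)
    (f' := fun t => Real.exp (c * (t - a)) * c * (f t - g) + Real.exp (c * (t - a)) * f' t) (by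
      filter_upwards [h] with t ht
      refine ⟨?_, ?_⟩
      · have h1 : HasDerivAt (fun t => Real.exp (c * (t - a))) (Real.exp (c * (t - a)) * c) t := by
          simpa using (((hasDerivAt_id t).sub_const a).const_mul c).exp
        exact h1.mul (ht.1.sub_const g)
      · have := mul_le_mul_of_nonneg_left ht.2 (Real.exp_pos (c * (t - a))).le
        linarith)
  simp only [Pi.mul_apply, Pi.sub_apply, sub_self, mul_zero, Real.exp_zero, one_mul, zero_mul,
    sub_nonpos] at key
  have h2 : Real.exp (-c * (b - a)) * Real.exp (c * (b - a)) = 1 := by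
    rw [← Real.exp_add]; simp
  have h3 := mul_le_mul_of_nonneg_left key (Real.exp_pos (-c * (b - a))).le
  rw [← mul_assoc, h2] at h3
  linarith

/-- Pairing f with the fixed vector v = f b - f a reduces to the scalar case and gives ‖v‖² ≤ ‖v‖ M
(b - a). -/
theorem AbsolutelyContinuousOnInterval.norm_sub_le {X : Type*} [NormedAddCommGroup X]
    [InnerProductSpace ℝ X] {f f' : ℝ → X} {a b M : ℝ} (hab : a ≤ b)
    (hf : AbsolutelyContinuousOnInterval f a b)
    (h : ∀ᵐ t ∂(volume.restrict (Icc a b)), HasDerivAt f (f' t) t ∧ ‖f' t‖ ≤ M) :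
    ‖f b - f a‖ ≤ M * (b - a) := by
  set v := f b - f a with hv
  have hL : LocallyLipschitz fun x : X => inner ℝ v x :=
    (innerSL ℝ v).lipschitz.locallyLipschitz
  have key := (hf.comp_locallyLipschitz hL).sub_le_mul hab (M := ‖v‖ * M)
    (f' := fun t => inner ℝ v (f' t)) (by
      filter_upwards [h] with t ht
      refine ⟨(innerSL ℝ v).hasFDerivAt.comp_hasDerivAt t ht.1, ?_⟩
      exact (real_inner_le_norm _ _).trans (mul_le_mul_of_nonneg_left ht.2 (norm_nonneg _)))
  rw [← inner_sub_right, ← hv, real_inner_self_eq_norm_sq] at key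
  rcases (norm_nonneg v).eq_or_lt with h0 | h0
  · rw [← h0] at key ⊢
    rcases hab.eq_or_lt with h1 | h1
    · simp [h1]
    -- When v = 0 the claim needs M ≥ 0, which follows from the bound at any one point of an
    -- interval of positive measure.
    · have : (volume.restrict (Icc a b)) ≠ 0 := by
        simp [Measure.restrict_eq_zero, h1]
      have : (ae (volume.restrict (Icc a b))).NeBot := ae_neBot.2 this
      obtain ⟨t, ht⟩ := h.exists
      exact mul_nonneg ((norm_nonneg _).trans ht.2) (by linarith)
  · have : ‖v‖ * ‖v‖ ≤ ‖v‖ * (M * (b - a)) := by nlinarith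
    exact le_of_mul_le_mul_left this h0

end AbsolutelyContinuous

/-! ## Hybrid time domains -/

/-- `t j` is the time of the `j`-th jump of the hybrid time domain `E`, with `t 0 = 0`. -/
structure HasJumpTimes (E : Set (ℝ × ℕ)) (t : ℕ → ℝ) : Prop where
  zero : t 0 = 0
  mono : Monotone t
  origin : (0, 0) ∈ E
  le : ∀ {s j}, (s, j) ∈ E → t j ≤ s
  mem : ∀ {s j}, (s, j) ∈ E → ∀ {r}, t j ≤ r → r ≤ s → (r, j) ∈ E
  prev : ∀ {s j}, (s, j) ∈ E → ∀ {k}, k < j → timeSlice E k = Icc (t k) (t (k + 1))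

/-- Absorbs the different shapes of the last interval once and for all: the estimates below only use
that a slice starts at `t j` and that all slices before a nonempty one are compact. -/
theorem IsHybridTimeDomain.exists_hasJumpTimes {E : Set (ℝ × ℕ)} (hE : IsHybridTimeDomain E) :
    ∃ t, HasJumpTimes E t := by
  obtain ⟨t, h0, hm, h⟩ := hE
  have hmem : ∀ s j, (s, j) ∈ E ↔ s ∈ timeSlice E j := fun s j => Iff.rfl
  refine ⟨t, h0, hm, ?_, ?_, ?_, ?_⟩
  · rw [hmem]
    rcases h with h | ⟨J, h1, h2, -⟩
    · rw [h, h0]; exact ⟨le_rfl, h0 ▸ hm (Nat.zero_le _)⟩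
    · rcases J.eq_zero_or_pos with rfl | hJ
      · rcases h2 with h2 | ⟨h3, h2⟩ | h2 <;> rw [h2]
        · exact ⟨h0.le, h0 ▸ hm (Nat.zero_le _)⟩
        · exact ⟨h0.le, h0 ▸ h3⟩
        · exact h0.le
      · rw [h1 0 hJ]; exact ⟨h0.le, h0 ▸ hm (Nat.zero_le _)⟩
  · intro s j hs
    rw [hmem] at hs
    rcases h with h | ⟨J, h1, h2, h3⟩
    · rw [h] at hs; exact hs.1
    · rcases lt_trichotomy j J with hj | rfl | hj
      · rw [h1 j hj] at hs; exact hs.1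
      · rcases h2 with h2 | ⟨-, h2⟩ | h2 <;> rw [h2] at hs
        exacts [hs.1, hs.1, hs]
      · rw [h3 j hj] at hs; exact hs.elim
  · intro s j hs r hr hrs
    rw [hmem] at hs ⊢
    rcases h with h | ⟨J, h1, h2, h3⟩
    · rw [h] at hs ⊢; exact ⟨hr, hrs.trans hs.2⟩
    · rcases lt_trichotomy j J with hj | rfl | hj
      · rw [h1 j hj] at hs ⊢; exact ⟨hr, hrs.trans hs.2⟩
      · rcases h2 with h2 | ⟨-, h2⟩ | h2 <;> rw [h2] at hs ⊢
        exacts [⟨hr, hrs.trans hs.2⟩, ⟨hr, hrs.trans_lt hs.2⟩, hr]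
      · rw [h3 j hj] at hs; exact hs.elim
  · intro s j hs k hk
    rcases h with h | ⟨J, h1, h2, h3⟩
    · exact h k
    · refine h1 k (hk.trans_le (le_of_not_gt fun hj => ?_))
      rw [hmem, h3 j hj] at hs; exact hs

namespace HasJumpTimes

variable {E : Set (ℝ × ℕ)} {t : ℕ → ℝ}

theorem start_mem (h : HasJumpTimes E t) {s : ℝ} {j : ℕ} (hs : (s, j) ∈ E) : (t j, j) ∈ E :=
  h.mem hs le_rfl (h.le hs)

theorem end_mem (h : HasJumpTimes E t) {s : ℝ} {j : ℕ} (hs : (s, j + 1) ∈ E) :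
    (t (j + 1), j) ∈ E := by
  have : t (j + 1) ∈ timeSlice E j := by
    rw [h.prev hs (Nat.lt_succ_self j)]
    exact ⟨h.mono (Nat.le_succ j), le_rfl⟩
  exact this

theorem jump_mem (h : HasJumpTimes E t) {s : ℝ} {j : ℕ} (hs : (s, j + 1) ∈ E) :
    (t (j + 1), j) ∈ jumpPoints E :=
  ⟨h.end_mem hs, h.start_mem hs⟩

theorem eq_of_jump (h : HasJumpTimes E t) {s : ℝ} {j : ℕ} (hs : (s, j) ∈ jumpPoints E) :
    s = t (j + 1) := by
  refine le_antisymm ?_ (h.le hs.2)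
  have h1 : s ∈ timeSlice E j := hs.1
  rw [h.prev hs.2 (Nat.lt_succ_self j)] at h1
  exact h1.2

theorem nonneg (h : HasJumpTimes E t) {s : ℝ} {j : ℕ} (hs : (s, j) ∈ E) : 0 ≤ s :=
  (h.zero ▸ h.mono (Nat.zero_le j)).trans (h.le hs)

theorem ordConnected_timeSlice (h : HasJumpTimes E t) (j : ℕ) : (timeSlice E j).OrdConnected :=
  ⟨fun _ ha _ hb _ hr => h.mem hb ((h.le ha).trans hr.1) hr.2⟩

theorem Icc_subset (h : HasJumpTimes E t) {r s : ℝ} {j : ℕ} (hr : t j ≤ r) (hs : (s, j) ∈ E) :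
    Icc r s ⊆ timeSlice E j := fun _ hx => h.mem hs (hr.trans hx.1) hx.2

/-- Earlier slices end at or before `t j`. The left endpoint is excluded because at a jump time the
first counter is the one before the jump. -/
theorem firstCounter_eq (h : HasJumpTimes E t) {s r : ℝ} {j : ℕ} (hs : (s, j) ∈ E)
    (hr : r ∈ Ioc (t j) s) : firstCounter E r = j := by
  have hmem : (r, j) ∈ E := h.mem hs hr.1.le hr.2
  refine le_antisymm (Nat.sInf_le hmem) (le_csInf ⟨j, hmem⟩ fun k hk => le_of_not_gt fun hkj => ?_)
  have h1 : r ∈ timeSlice E k := hk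
  rw [h.prev hs hkj] at h1
  exact absurd (h1.2.trans (h.mono hkj)) (not_le.2 hr.1)

theorem Icc_subset_ordinaryTimes (h : HasJumpTimes E t) {s : ℝ} {j : ℕ} (hs : (s, j) ∈ E) :
    Icc 0 s ⊆ ordinaryTimes E := by
  induction j generalizing s with
  | zero => exact fun r hr => ⟨0, h.mem hs (h.zero ▸ hr.1) hr.2⟩
  | succ j ih =>
    intro r hr
    rcases le_total r (t (j + 1)) with h1 | h1
    · exact ih (h.end_mem hs) ⟨hr.1, h1⟩
    · exact ⟨j + 1, h.mem hs h1 hr.2⟩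

/-- The ordinary times are exhausted by a sequence of compact intervals. -/
theorem exists_monotone_iUnion (h : HasJumpTimes E t) : ∃ x : ℕ → ℝ, Monotone x ∧
    (∀ n, x n ∈ ordinaryTimes E) ∧ ordinaryTimes E = ⋃ n, Icc 0 (x n) := by
  have hoc : (ordinaryTimes E).OrdConnected := by
    refine ⟨fun a ⟨i, ha⟩ b ⟨j, hb⟩ r hr => ?_⟩
    exact h.Icc_subset_ordinaryTimes hb ⟨(h.nonneg ha).trans hr.1, hr.2⟩
  have : Nonempty (ordinaryTimes E) := ⟨⟨0, 0, h.origin⟩⟩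
  obtain ⟨x, hx, hxt⟩ := Filter.exists_seq_monotone_tendsto_atTop_atTop (ordinaryTimes E)
  refine ⟨fun n => x n, fun m n hmn => hx hmn, fun n => (x n).2, ?_⟩
  refine subset_antisymm (fun r hr => ?_) (iUnion_subset fun n => ?_)
  · obtain ⟨n, hn⟩ := (hxt.eventually (Filter.eventually_ge_atTop ⟨r, hr⟩)).exists
    obtain ⟨j, hj⟩ := hr
    exact mem_iUnion.2 ⟨n, h.nonneg hj, hn⟩
  · obtain ⟨j, hj⟩ := (x n).2
    exact h.Icc_subset_ordinaryTimes hj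

end HasJumpTimes

/-! ## Solution pairs -/

/-- Removing the jump points takes at most the single time `t (j + 1)` from slice j, hence a null
set. -/
theorem ae_norm_le_of_linfNorm {V : Type*} [NormedAddCommGroup V] {E : Set (ℝ × ℕ)}
    {t : ℕ → ℝ} (hE : HasJumpTimes E t) {u : ℝ → ℕ → V} (hu : linfNorm E u < ∞) (j : ℕ) :
    ∀ᵐ s ∂(volume.restrict (timeSlice E j)), ‖u s j‖ ≤ (linfNorm E u).toReal := by
  have hset : (timeSlice (E \ jumpPoints E) j : Set ℝ) =ᵐ[volume] timeSlice E j := by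
    have h0 : ∀ᵐ s : ℝ, s ≠ t (j + 1) := by simp [ae_iff, measure_singleton]
    filter_upwards [h0] with s hs
    refine propext ⟨fun h => h.1, fun h => ⟨h, fun h' => hs (hE.eq_of_jump h')⟩⟩
  rw [← Measure.restrict_congr_set hset]
  filter_upwards [ae_le_essSup (μ := volume.restrict (timeSlice (E \ jumpPoints E) j))
    (f := fun s => ‖u s j‖ₑ)] with s hs
  have h1 : ‖u s j‖ₑ ≤ linfNorm E u :=
    hs.trans ((le_iSup (fun j => essSup (fun t => ‖u t j‖ₑ)
      (volume.restrict (timeSlice (E \ jumpPoints E) j))) j).trans (le_max_left _ _))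
  rw [← toReal_enorm]
  exact ENNReal.toReal_mono hu.ne h1

theorem norm_le_of_linfNorm {V : Type*} [NormedAddCommGroup V] {E : Set (ℝ × ℕ)}
    {u : ℝ → ℕ → V} (hu : linfNorm E u < ∞) {s : ℝ} {j : ℕ} (hs : (s, j) ∈ jumpPoints E) :
    ‖u s j‖ ≤ (linfNorm E u).toReal := by
  have h1 : ‖u s j‖ₑ ≤ linfNorm E u :=
    (le_iSup₂ (f := fun (p : ℝ × ℕ) (_ : p ∈ jumpPoints E) => ‖u p.1 p.2‖ₑ) (s, j) hs).trans
      (le_max_right _ _)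
  rw [← toReal_enorm]
  exact ENNReal.toReal_mono hu.ne h1

theorem norm_fst_le_pairInput {W Y : Type*} [NormedAddCommGroup W] [NormedAddCommGroup Y]
    (w : ℝ → ℕ → W) (η : ℝ → ℕ → Y) (s : ℝ) (j : ℕ) : ‖w s j‖ ≤ ‖pairInput w η s j‖ := by
  have := WithLp.norm_fst_le (x := pairInput w η s j)
  simpa [pairInput] using this

theorem norm_snd_le_pairInput {W Y : Type*} [NormedAddCommGroup W] [NormedAddCommGroup Y]
    (w : ℝ → ℕ → W) (η : ℝ → ℕ → Y) (s : ℝ) (j : ℕ) : ‖η s j‖ ≤ ‖pairInput w η s j‖ := by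
  have := WithLp.norm_snd_le (x := pairInput w η s j)
  simpa [pairInput] using this

namespace IsSolutionPair

variable {X W Y : Type*} [NormedAddCommGroup X] [NormedSpace ℝ X]
    [NormedAddCommGroup W] [NormedAddCommGroup Y] {Sys : HybridSystem X W Y}
    {E : Set (ℝ × ℕ)} {φ : ℝ → ℕ → X} {w : ℝ → ℕ → W} {η : ℝ → ℕ → Y} {t : ℕ → ℝ}

theorem absolutelyContinuous (h : IsSolutionPair Sys E φ w η) (hE : HasJumpTimes E t)
    {r s : ℝ} {j : ℕ} (hr : t j ≤ r) (hrs : r ≤ s) (hs : (s, j) ∈ E) :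
    AbsolutelyContinuousOnInterval (fun s => φ s j) r s :=
  h.arc j r (hE.mem hs hr hrs) s hs

theorem ae_flow (h : IsSolutionPair Sys E φ w η) (hE : HasJumpTimes E t)
    {r s : ℝ} {j : ℕ} (hr : t j ≤ r) (hs : (s, j) ∈ E) :
    ∀ᵐ x ∂(volume.restrict (Icc r s)),
      φ x j ∈ Sys.flowSet ∧ HasDerivAt (fun s => φ s j) (Sys.flow (φ x j) (w x j)) x :=
  ae_restrict_of_ae_restrict_of_subset (hE.Icc_subset hr hs) (h.flows j)

theorem jump (h : IsSolutionPair Sys E φ w η) (hE : HasJumpTimes E t) {s : ℝ} {j : ℕ}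
    (hs : (s, j + 1) ∈ E) : φ (t (j + 1)) j ∈ Sys.jumpSet ∧
      φ (t (j + 1)) (j + 1) ∈ Sys.jump (φ (t (j + 1)) j) (η (t (j + 1)) j) :=
  h.jumps _ _ (hE.jump_mem hs)

end IsSolutionPair

/-! ## The quadratic form of the design matrix -/

theorem dotProduct_transpose_mulVec' {m n : Type*} [Fintype m] [Fintype n] (M : Matrix m n ℝ)
    (u : n → ℝ) (v : m → ℝ) : u ⬝ᵥ (Mᵀ *ᵥ v) = v ⬝ᵥ (M *ᵥ u) := by
  rw [mulVec_transpose, dotProduct_comm, dotProduct_mulVec]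

theorem isUnit_of_forall_mulVec_eq_zero {n : Type*} [Fintype n] [DecidableEq n]
    {M : Matrix n n ℝ} (h : ∀ v, M *ᵥ v = 0 → v = 0) : IsUnit M := by
  rw [← mulVec_injective_iff_isUnit]
  intro u v huv
  exact sub_eq_zero.1 (h _ (by rw [mulVec_sub]; exact sub_eq_zero.2 huv))

namespace Plant

variable {nz ny nw nq ns np : ℕ}

/-- The grouping anticipates J = XᵀL and W = UᵀH: the terms with multipliers then become products of
X(a + ε) and Ub with the residuals of the two error equations. Here a and b are still arbitrary. -/
theorem designMatrix_quadratic (P : Plant nz ny nw nq ns np) (ℓ lam γ δ χ e : ℝ)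
    (P₁ X : Matrix (Fin nz) (Fin nz) ℝ) (P₂ U W : Matrix (Fin ny) (Fin ny) ℝ)
    (J : Matrix (Fin nz) (Fin ny) ℝ) (a ε : Fin nz → ℝ) (b θ : Fin ny → ℝ) (w : Fin nw → ℝ)
    (ζ : Fin ns → ℝ) :
    Sum.elim (Sum.elim (Sum.elim a b) (Sum.elim ε θ)) (Sum.elim w ζ) ⬝ᵥ
      (P.designMatrix ℓ lam γ δ χ e P₁ X P₂ U W J *ᵥ
        Sum.elim (Sum.elim (Sum.elim a b) (Sum.elim ε θ)) (Sum.elim w ζ)) =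
      2 * ((X *ᵥ a + X *ᵥ ε) ⬝ᵥ (P.A *ᵥ ε + P.N *ᵥ w + P.B *ᵥ ζ - a)
        + (a + ε) ⬝ᵥ (J *ᵥ (θ - P.C *ᵥ ε))
        + (U *ᵥ b) ⬝ᵥ (P.C *ᵥ a - b) + b ⬝ᵥ (W *ᵥ (θ - P.C *ᵥ ε))
        + a ⬝ᵥ (P₁ *ᵥ ε) + e * (b ⬝ᵥ (P₂ *ᵥ θ)))
      + 2 * lam * (ε ⬝ᵥ (P₁ *ᵥ ε)) + (P.Cp *ᵥ ε) ⬝ᵥ (P.Cp *ᵥ ε)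
      + χ * ℓ ^ 2 * ((P.S *ᵥ ε) ⬝ᵥ (P.S *ᵥ ε)) + (-δ + 2 * lam) * e * (θ ⬝ᵥ (P₂ *ᵥ θ))
      - γ ^ 2 * (w ⬝ᵥ w) - χ * (ζ ⬝ᵥ ζ) := by
  simp only [designMatrix, he, fromBlocks_mulVec, fromRows_mulVec, fromBlocks_transpose,
    transpose_fromRows, fromBlocks_add, Sum.elim_comp_inl, Sum.elim_comp_inr,
    fromCols_mulVec, sumElim_dotProduct_sumElim, dotProduct_add, add_dotProduct, dotProduct_sub,
    mulVec_sub, Matrix.add_mulVec, Matrix.sub_mulVec, Matrix.neg_mulVec, dotProduct_neg,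
    transpose_mul, transpose_add, transpose_sub, transpose_neg, transpose_transpose,
    transpose_zero, transpose_smul, Matrix.smul_mulVec, dotProduct_smul, smul_eq_mul, zero_mulVec,
    dotProduct_zero, one_mulVec, ← mulVec_mulVec, dotProduct_transpose_mulVec']
  have hJ : ∀ u v, (Jᵀ *ᵥ u) ⬝ᵥ v = u ⬝ᵥ (J *ᵥ v) := fun u v => by
    rw [dotProduct_comm, dotProduct_transpose_mulVec']
  have hW : ∀ u v, (Wᵀ *ᵥ u) ⬝ᵥ v = u ⬝ᵥ (W *ᵥ v) := fun u v => by
    rw [dotProduct_comm, dotProduct_transpose_mulVec']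
  rw [hJ, hJ, hW, dotProduct_comm (P.C *ᵥ a), dotProduct_comm (P.A *ᵥ ε) (X *ᵥ a),
    dotProduct_comm (P.A *ᵥ ε) (X *ᵥ ε), dotProduct_comm (P.N *ᵥ w) (X *ᵥ a),
    dotProduct_comm (P.N *ᵥ w) (X *ᵥ ε), dotProduct_comm (P.B *ᵥ ζ) (X *ᵥ a),
    dotProduct_comm (P.B *ᵥ ζ) (X *ᵥ ε), dotProduct_comm (X *ᵥ a) a, dotProduct_comm (X *ᵥ ε) a,
    dotProduct_comm (U *ᵥ b) b]
  ring

theorem DesignLMI.isUnit {P : Plant nz ny nw nq ns np} {ℓ T₂ lam γ δ χ : ℝ}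
    {P₁ X : Matrix (Fin nz) (Fin nz) ℝ} {P₂ U W : Matrix (Fin ny) (Fin ny) ℝ}
    {J : Matrix (Fin nz) (Fin ny) ℝ} (h : P.DesignLMI ℓ T₂ lam γ δ χ P₁ X P₂ U W J) :
    IsUnit X ∧ IsUnit U := by
  -- On a vector supported in the first block the form is -2(Xa)·a, or -2(Ub)·b, so a kernel vector
  -- of X or U would make a definite form vanish.
  refine ⟨isUnit_of_forall_mulVec_eq_zero fun a ha => ?_,
    isUnit_of_forall_mulVec_eq_zero fun b hb => ?_⟩
  · by_contra hne
    have := h.1.dotProduct_mulVec_pos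
      (x := Sum.elim (Sum.elim (Sum.elim a 0) (Sum.elim 0 0)) (Sum.elim 0 0)) (by
        contrapose! hne
        ext i
        exact congrFun hne (Sum.inl (Sum.inl (Sum.inl i))))
    rw [star_trivial, Matrix.neg_mulVec, dotProduct_neg, designMatrix_quadratic, ha] at this
    simp at this
  · by_contra hne
    have := h.1.dotProduct_mulVec_pos
      (x := Sum.elim (Sum.elim (Sum.elim 0 b) (Sum.elim 0 0)) (Sum.elim 0 0)) (by
        contrapose! hne
        ext i
        exact congrFun hne (Sum.inl (Sum.inl (Sum.inr i))))
    rw [star_trivial, Matrix.neg_mulVec, dotProduct_neg, designMatrix_quadratic, hb] at this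
    simp at this

/-- The quadratic inequality behind the design matrix, for every value `e` between `1` and
`exp (δ T₂)`, evaluated along the error dynamics `a = ε'`, `b = θ'`. -/
theorem DesignLMI.quadratic_le {P : Plant nz ny nw nq ns np} {ℓ T₂ lam γ δ χ : ℝ}
    {P₁ X : Matrix (Fin nz) (Fin nz) ℝ} {P₂ U W : Matrix (Fin ny) (Fin ny) ℝ}
    {J : Matrix (Fin nz) (Fin ny) ℝ} (h : P.DesignLMI ℓ T₂ lam γ δ χ P₁ X P₂ U W J)
    {e : ℝ} (he : e ∈ Icc 1 (Real.exp (δ * T₂))) {a ε : Fin nz → ℝ} {b θ : Fin ny → ℝ}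
    {w : Fin nw → ℝ} {ζ : Fin ns → ℝ}
    (ha : a = P.A *ᵥ ε + (Xᵀ⁻¹ * J) *ᵥ (θ - P.C *ᵥ ε) + P.B *ᵥ ζ + P.N *ᵥ w)
    (hb : b = P.C *ᵥ a + (Uᵀ⁻¹ * W) *ᵥ (θ - P.C *ᵥ ε)) :
    2 * (a ⬝ᵥ (P₁ *ᵥ ε) + e * (b ⬝ᵥ (P₂ *ᵥ θ))) - δ * e * (θ ⬝ᵥ (P₂ *ᵥ θ)) ≤
      -(2 * lam) * (ε ⬝ᵥ (P₁ *ᵥ ε) + e * (θ ⬝ᵥ (P₂ *ᵥ θ)))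
      - (P.Cp *ᵥ ε) ⬝ᵥ (P.Cp *ᵥ ε) + γ ^ 2 * (w ⬝ᵥ w)
      + χ * (ζ ⬝ᵥ ζ - ℓ ^ 2 * ((P.S *ᵥ ε) ⬝ᵥ (P.S *ᵥ ε))) := by
  obtain ⟨hX, hU⟩ := h.isUnit
  have hX' : IsUnit Xᵀ.det := by rwa [det_transpose, ← isUnit_iff_isUnit_det]
  have hU' : IsUnit Uᵀ.det := by rwa [det_transpose, ← isUnit_iff_isUnit_det]
  have hJ : ∀ u v, u ⬝ᵥ (J *ᵥ v) = (X *ᵥ u) ⬝ᵥ ((Xᵀ⁻¹ * J) *ᵥ v) := fun u v => by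
    rw [dotProduct_comm (X *ᵥ u), ← dotProduct_transpose_mulVec' X, mulVec_mulVec,
      mul_nonsing_inv_cancel_left _ _ hX']
  have hW : ∀ u v, u ⬝ᵥ (W *ᵥ v) = (U *ᵥ u) ⬝ᵥ ((Uᵀ⁻¹ * W) *ᵥ v) := fun u v => by
    rw [dotProduct_comm (U *ᵥ u), ← dotProduct_transpose_mulVec' U, mulVec_mulVec,
      mul_nonsing_inv_cancel_left _ _ hU']
  have key : ∀ e', (-(P.designMatrix ℓ lam γ δ χ e' P₁ X P₂ U W J)).PosDef →
      2 * (a ⬝ᵥ (P₁ *ᵥ ε) + e' * (b ⬝ᵥ (P₂ *ᵥ θ))) + 2 * lam * (ε ⬝ᵥ (P₁ *ᵥ ε))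
        + (P.Cp *ᵥ ε) ⬝ᵥ (P.Cp *ᵥ ε) + χ * ℓ ^ 2 * ((P.S *ᵥ ε) ⬝ᵥ (P.S *ᵥ ε))
        + (-δ + 2 * lam) * e' * (θ ⬝ᵥ (P₂ *ᵥ θ)) - γ ^ 2 * (w ⬝ᵥ w) - χ * (ζ ⬝ᵥ ζ) ≤ 0 := by
    intro e' he'
    have h1 := he'.posSemidef.dotProduct_mulVec_nonneg
      (Sum.elim (Sum.elim (Sum.elim a b) (Sum.elim ε θ)) (Sum.elim w ζ))
    rw [star_trivial, Matrix.neg_mulVec, dotProduct_neg, designMatrix_quadratic, hJ, hW,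
      mulVec_add] at h1
    -- Along the dynamics the J-term cancels the X-term, and below the W-term cancels the U-term;
    -- only terms free of multipliers survive.
    have e1 : P.A *ᵥ ε + P.N *ᵥ w + P.B *ᵥ ζ - a = -((Xᵀ⁻¹ * J) *ᵥ (θ - P.C *ᵥ ε)) := by
      rw [ha]; abel
    have e2 : P.C *ᵥ a - b = -((Uᵀ⁻¹ * W) *ᵥ (θ - P.C *ᵥ ε)) := by
      rw [hb]; abel
    rw [e1, e2, dotProduct_neg, dotProduct_neg] at h1
    linarith
  have h1 := key 1 h.1
  have h2 := key _ h.2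
  set q := b ⬝ᵥ (P₂ *ᵥ θ)
  set r := θ ⬝ᵥ (P₂ *ᵥ θ)
  -- An affine function of e that is nonpositive at both ends of an interval is nonpositive in
  -- between; y collects the coefficient of e.
  have hm : ∀ x y : ℝ, x + 1 * y ≤ 0 → x + Real.exp (δ * T₂) * y ≤ 0 → x + e * y ≤ 0 := by
    intro x y hx hy
    rcases le_total 0 y with hy0 | hy0
    · linarith [mul_le_mul_of_nonneg_right he.2 hy0]
    · linarith [mul_le_mul_of_nonpos_right he.1 hy0]
  have := hm (2 * (a ⬝ᵥ (P₁ *ᵥ ε)) + 2 * lam * (ε ⬝ᵥ (P₁ *ᵥ ε))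
    + (P.Cp *ᵥ ε) ⬝ᵥ (P.Cp *ᵥ ε) + χ * ℓ ^ 2 * ((P.S *ᵥ ε) ⬝ᵥ (P.S *ᵥ ε))
    - γ ^ 2 * (w ⬝ᵥ w) - χ * (ζ ⬝ᵥ ζ)) (2 * q + (-δ + 2 * lam) * r) (by linarith) (by linarith)
  linarith

end Plant

/-! ## Quadratic forms -/

/-- The constant is the minimum of the Rayleigh quotient, which is homogeneous of degree 0. The
sphere is that of the sup norm, so the division by v·v cannot be omitted. -/
theorem exists_le_of_posDef {n : Type*} [Fintype n] {M : Matrix n n ℝ} (hM : M.PosDef) :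
    ∃ m > 0, ∀ v : n → ℝ, m * (v ⬝ᵥ v) ≤ v ⬝ᵥ (M *ᵥ v) := by
  have hcont : Continuous fun v : n → ℝ => v ⬝ᵥ (M *ᵥ v) := by fun_prop
  have hself : Continuous fun v : n → ℝ => v ⬝ᵥ v := by fun_prop
  rcases (Metric.sphere (0 : n → ℝ) 1).eq_empty_or_nonempty with h0 | h0
  -- The sphere is empty only in dimension 0.
  · refine ⟨1, one_pos, fun v => ?_⟩
    have : v = 0 := by
      by_contra hv
      have : ‖v‖⁻¹ • v ∈ Metric.sphere (0 : n → ℝ) 1 := by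
        simp [norm_smul, norm_ne_zero_iff.2 hv]
      rw [h0] at this
      exact this
    simp [this]
  have hpos : ∀ v ∈ Metric.sphere (0 : n → ℝ) 1, 0 < v ⬝ᵥ v := fun v hv => by
    have hv' : v ≠ 0 := by rintro rfl; simp at hv
    have : v ⬝ᵥ star v > 0 := dotProduct_star_self_pos_iff.2 hv'
    simpa using this
  obtain ⟨v₀, hv₀, hmin⟩ := (isCompact_sphere (0 : n → ℝ) 1).exists_isMinOn h0
    (f := fun v => (v ⬝ᵥ (M *ᵥ v)) / (v ⬝ᵥ v))
    (hcont.continuousOn.div hself.continuousOn fun v hv => (hpos v hv).ne')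
  have hv₀' : v₀ ≠ 0 := by rintro rfl; simp at hv₀
  have h1 := hM.dotProduct_mulVec_pos hv₀'
  rw [star_trivial] at h1
  refine ⟨_, div_pos h1 (hpos v₀ hv₀), fun v => ?_⟩
  rcases eq_or_ne v 0 with rfl | hv
  · simp
  have hs : ‖v‖⁻¹ • v ∈ Metric.sphere (0 : n → ℝ) 1 := by
    simp [norm_smul, norm_ne_zero_iff.2 hv]
  have h2 := hmin hs
  simp only [mem_ofPred_eq] at h2
  rw [le_div_iff₀ (hpos _ hs)] at h2
  simp only [mulVec_smul, dotProduct_smul, smul_dotProduct, smul_eq_mul] at h2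
  have h3 : 0 < ‖v‖⁻¹ := inv_pos.2 (norm_pos_iff.2 hv)
  have h4 : ‖v‖⁻¹ * (‖v‖⁻¹ * (v₀ ⬝ᵥ M *ᵥ v₀ / v₀ ⬝ᵥ v₀ * (v ⬝ᵥ v))) ≤
      ‖v‖⁻¹ * (‖v‖⁻¹ * (v ⬝ᵥ M *ᵥ v)) := by linarith
  exact le_of_mul_le_mul_left (le_of_mul_le_mul_left h4 h3) h3

theorem dotProduct_self_eq_norm_sq {n : Type*} [Fintype n] (v : n → ℝ) :
    v ⬝ᵥ v = ‖(WithLp.toLp 2 v : EuclideanSpace ℝ n)‖ ^ 2 := by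
  rw [EuclideanSpace.real_norm_sq_eq]
  simp [dotProduct, sq]

theorem norm_toLp_mulVec_le {m n : Type*} [Fintype m] [Fintype n] [DecidableEq n]
    (M : Matrix m n ℝ) :
    ∃ K > 0, ∀ v : n → ℝ, ‖(WithLp.toLp 2 (M *ᵥ v) : EuclideanSpace ℝ m)‖ ≤
      K * ‖(WithLp.toLp 2 v : EuclideanSpace ℝ n)‖ := by
  let T : EuclideanSpace ℝ n →L[ℝ] EuclideanSpace ℝ m :=
    LinearMap.toContinuousLinearMap (Matrix.toLpLin 2 2 M)
  refine ⟨‖T‖ + 1, by positivity, fun v => ?_⟩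
  refine (T.le_opNorm (WithLp.toLp 2 v)).trans ?_
  gcongr
  linarith

theorem exists_quadratic_le {n : Type*} [Fintype n] [DecidableEq n] (M : Matrix n n ℝ) :
    ∃ K > 0, ∀ v : n → ℝ, v ⬝ᵥ (M *ᵥ v) ≤ K * (v ⬝ᵥ v) := by
  obtain ⟨K, hK, h⟩ := norm_toLp_mulVec_le M
  refine ⟨K, hK, fun v => ?_⟩
  have h1 : v ⬝ᵥ (M *ᵥ v) = inner ℝ (WithLp.toLp 2 (M *ᵥ v) : EuclideanSpace ℝ n)
      (WithLp.toLp 2 v) := by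
    simp [EuclideanSpace.inner_eq_star_dotProduct]
  rw [h1, dotProduct_self_eq_norm_sq]
  refine (real_inner_le_norm _ _).trans ?_
  nlinarith [mul_le_mul_of_nonneg_right (h v)
    (norm_nonneg (WithLp.toLp 2 v : EuclideanSpace ℝ n))]

theorem hasDerivAt_quadratic {n : Type*} [Fintype n] {M : Matrix n n ℝ} (hM : M.IsSymm)
    {u : ℝ → n → ℝ} {u' : n → ℝ} {t : ℝ} (hu : HasDerivAt u u' t) :
    HasDerivAt (fun s => u s ⬝ᵥ (M *ᵥ u s)) (2 * (u' ⬝ᵥ (M *ᵥ u t))) t := by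
  have hM' : HasDerivAt (fun s => M *ᵥ u s) (M *ᵥ u') t :=
    (LinearMap.toContinuousLinearMap (Matrix.mulVecLin M)).hasFDerivAt.comp_hasDerivAt t hu
  rw [hasDerivAt_pi] at hu hM'
  have h := HasDerivAt.fun_sum (u := Finset.univ) fun i _ => (hu i).mul (hM' i)
  convert! h using 1
  rw [Finset.sum_add_distrib]
  change _ = u' ⬝ᵥ (M *ᵥ u t) + u t ⬝ᵥ (M *ᵥ u')
  rw [← dotProduct_transpose_mulVec' M u' (u t), hM.eq]
  ring

/-! ## The distance to the attractor -/

namespace HState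

variable {nz ny : ℕ}

/-- The component `θ̃`. -/
def θ (x : HState nz ny) : Fin ny → ℝ := fun i => x.err (Sum.inr i)

theorem err_eq (x : HState nz ny) : x.err = Sum.elim x.ε x.θ := by
  ext (i | i) <;> rfl

theorem err_dotProduct (x : HState nz ny) :
    x.err ⬝ᵥ x.err = x.ε ⬝ᵥ x.ε + x.θ ⬝ᵥ x.θ := by
  rw [err_eq, sumElim_dotProduct_sumElim]

theorem norm_sq_eq (x : HState nz ny) :
    ‖x‖ ^ 2 = x.z ⬝ᵥ x.z + (x.err ⬝ᵥ x.err + x.τ ^ 2) := by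
  rw [EuclideanSpace.real_norm_sq_eq, Fintype.sum_sum_type, Fintype.sum_sum_type]
  simp [dotProduct, sq, z, err, τ]

/-- The norm of the error variables `(ε, θ̃)`. -/
noncomputable def errNorm (x : HState nz ny) : ℝ := √(x.err ⬝ᵥ x.err)

theorem errNorm_nonneg (x : HState nz ny) : 0 ≤ x.errNorm := Real.sqrt_nonneg _

theorem errNorm_sq (x : HState nz ny) : x.errNorm ^ 2 = x.ε ⬝ᵥ x.ε + x.θ ⬝ᵥ x.θ := by
  rw [errNorm, Real.sq_sqrt, err_dotProduct]
  exact Finset.sum_nonneg fun i _ => mul_self_nonneg _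

/-- The nearest point is (z, 0, τ), which lies in the attractor because of the condition on the
timer. -/
theorem infDist_attractor {T₂ : ℝ} {x : HState nz ny} (hx : x.τ ∈ Icc 0 T₂) :
    Metric.infDist x (Plant.attractor nz ny T₂) = x.errNorm := by
  have hmem : (mk x.z 0 x.τ : HState nz ny) ∈ Plant.attractor nz ny T₂ := ⟨rfl, hx⟩
  refine le_antisymm ((Metric.infDist_le_dist_of_mem hmem).trans (le_of_eq ?_)) ?_
  · rw [dist_eq_norm, errNorm, ← Real.sqrt_sq (norm_nonneg _), norm_sq_eq]
    congr 1
    have h1 : (x - mk x.z 0 x.τ).z = 0 := by ext i; simp [z, mk]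
    have h2 : (x - mk x.z 0 x.τ).err = x.err := by ext i; simp [err, mk]
    have h3 : (x - mk x.z 0 x.τ).τ = 0 := by simp [τ, mk]
    rw [h1, h2, h3]
    simp
  · refine (Metric.le_infDist ⟨_, hmem⟩).2 fun y hy => ?_
    rw [dist_eq_norm, errNorm, ← Real.sqrt_sq (norm_nonneg (x - y)), norm_sq_eq]
    refine Real.sqrt_le_sqrt ?_
    have h2 : (x - y).err = x.err := by
      ext i
      have : y.err i = 0 := by rw [hy.1]; rfl
      simp only [err] at this ⊢
      simp [this]
    rw [h2]
    have : 0 ≤ (x - y).z ⬝ᵥ (x - y).z := Finset.sum_nonneg fun i _ => mul_self_nonneg _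
    nlinarith [sq_nonneg (x - y).τ]

/-! ## The Lyapunov function -/

/-- The Lyapunov function `εᵀ P₁ ε + exp(δ τ) θ̃ᵀ P₂ θ̃`. -/
noncomputable def lyap (P₁ : Matrix (Fin nz) (Fin nz) ℝ) (P₂ : Matrix (Fin ny) (Fin ny) ℝ)
    (δ : ℝ) (x : HState nz ny) : ℝ :=
  x.ε ⬝ᵥ (P₁ *ᵥ x.ε) + Real.exp (δ * x.τ) * (x.θ ⬝ᵥ (P₂ *ᵥ x.θ))

variable {P₁ : Matrix (Fin nz) (Fin nz) ℝ} {P₂ : Matrix (Fin ny) (Fin ny) ℝ} {δ : ℝ}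

theorem locallyLipschitz_lyap : LocallyLipschitz (lyap P₁ P₂ δ : HState nz ny → ℝ) := by
  refine ContDiff.locallyLipschitz (𝕂 := ℝ) ?_
  unfold lyap θ ε err τ mulVec dotProduct
  fun_prop

theorem hasDerivAt_apply {f : ℝ → HState nz ny} {f' : HState nz ny} {t : ℝ}
    (h : HasDerivAt f f' t) (i : Fin nz ⊕ ((Fin nz ⊕ Fin ny) ⊕ Unit)) :
    HasDerivAt (fun s => f s i) (f' i) t :=
  (EuclideanSpace.proj (𝕜 := ℝ) i).hasFDerivAt.comp_hasDerivAt t h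

/-- Since τ decreases at unit rate, the weight e^{δτ} contributes the negative term in δ, which
helps to compensate growth of θ̃ between samples. -/
theorem hasDerivAt_lyap (hP₁ : P₁.IsSymm) (hP₂ : P₂.IsSymm) {f : ℝ → HState nz ny}
    {f' : HState nz ny} {t : ℝ} (h : HasDerivAt f f' t) (hτ : f'.τ = -1) :
    HasDerivAt (fun s => (f s).lyap P₁ P₂ δ)
      (2 * (f'.ε ⬝ᵥ (P₁ *ᵥ (f t).ε) +
        Real.exp (δ * (f t).τ) * (f'.θ ⬝ᵥ (P₂ *ᵥ (f t).θ))) -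
        δ * Real.exp (δ * (f t).τ) * ((f t).θ ⬝ᵥ (P₂ *ᵥ (f t).θ))) t := by
  have h1 : HasDerivAt (fun s => (f s).ε) f'.ε t :=
    hasDerivAt_pi.2 fun i => hasDerivAt_apply h _
  have h2 : HasDerivAt (fun s => (f s).θ) f'.θ t :=
    hasDerivAt_pi.2 fun i => hasDerivAt_apply h _
  have h3 : HasDerivAt (fun s => (f s).τ) f'.τ t := hasDerivAt_apply h _
  rw [hτ] at h3
  convert! (hasDerivAt_quadratic hP₁ h1).add
    ((h3.const_mul δ).exp.mul (hasDerivAt_quadratic hP₂ h2)) using 1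
  ring

theorem exists_le_lyap (hP₁ : P₁.PosDef) (hP₂ : P₂.PosDef) (hδ : 0 < δ) :
    ∃ m > 0, ∀ x : HState nz ny, 0 ≤ x.τ → m * x.errNorm ^ 2 ≤ x.lyap P₁ P₂ δ := by
  obtain ⟨m₁, hm₁, h₁⟩ := exists_le_of_posDef hP₁
  obtain ⟨m₂, hm₂, h₂⟩ := exists_le_of_posDef hP₂
  refine ⟨min m₁ m₂, lt_min hm₁ hm₂, fun x hx => ?_⟩
  have hε : 0 ≤ x.ε ⬝ᵥ x.ε := Finset.sum_nonneg fun i _ => mul_self_nonneg _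
  have hθ : 0 ≤ x.θ ⬝ᵥ x.θ := Finset.sum_nonneg fun i _ => mul_self_nonneg _
  have he : 1 ≤ Real.exp (δ * x.τ) := Real.one_le_exp (by positivity)
  rw [errNorm_sq, lyap, mul_add]
  have e1 := (mul_le_mul_of_nonneg_right (min_le_left m₁ m₂) hε).trans (h₁ x.ε)
  have e2 := (mul_le_mul_of_nonneg_right (min_le_right m₁ m₂) hθ).trans (h₂ x.θ)
  have e3 : 0 ≤ x.θ ⬝ᵥ (P₂ *ᵥ x.θ) := (by positivity : 0 ≤ m₂ * (x.θ ⬝ᵥ x.θ)).trans (h₂ x.θ)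
  nlinarith [mul_le_mul_of_nonneg_right he e3]

theorem exists_lyap_le (P₁ : Matrix (Fin nz) (Fin nz) ℝ) (P₂ : Matrix (Fin ny) (Fin ny) ℝ)
    (hδ : 0 < δ) (T₂ : ℝ) :
    ∃ M > 0, ∀ x : HState nz ny, x.τ ≤ T₂ → x.lyap P₁ P₂ δ ≤ M * x.errNorm ^ 2 := by
  obtain ⟨m₁, hm₁, h₁⟩ := exists_quadratic_le P₁
  obtain ⟨m₂, hm₂, h₂⟩ := exists_quadratic_le P₂
  refine ⟨m₁ + Real.exp (δ * T₂) * m₂, by positivity, fun x hx => ?_⟩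
  have hε : 0 ≤ x.ε ⬝ᵥ x.ε := Finset.sum_nonneg fun i _ => mul_self_nonneg _
  have hθ : 0 ≤ x.θ ⬝ᵥ x.θ := Finset.sum_nonneg fun i _ => mul_self_nonneg _
  have he : Real.exp (δ * x.τ) ≤ Real.exp (δ * T₂) := Real.exp_le_exp.2 (by gcongr)
  rw [errNorm_sq, lyap]
  have e1 := h₁ x.ε
  have e2 : Real.exp (δ * x.τ) * (x.θ ⬝ᵥ (P₂ *ᵥ x.θ)) ≤
      Real.exp (δ * T₂) * (m₂ * (x.θ ⬝ᵥ x.θ)) :=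
    (mul_le_mul_of_nonneg_left (h₂ x.θ) (Real.exp_pos _).le).trans
      (mul_le_mul_of_nonneg_right he (by positivity))
  have e3 : 0 ≤ m₁ * (x.θ ⬝ᵥ x.θ) := by positivity
  have e4 : 0 ≤ Real.exp (δ * T₂) * m₂ * (x.ε ⬝ᵥ x.ε) := by positivity
  nlinarith

end HState

namespace Plant

variable {nz ny nw nq ns np : ℕ}

/-! ## The error dynamics -/

section ErrorDynamics

variable (P : Plant nz ny nw nq ns np) (L : Matrix (Fin nz) (Fin ny) ℝ)
  (H : Matrix (Fin ny) (Fin ny) ℝ) (T₁ T₂ : ℝ)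

theorem errorSystem_flow_τ (x : HState nz ny) (w : Vec nw) :
    ((P.errorSystem L H T₁ T₂).flow x w).τ = -1 := rfl

/-- Grouped by θ̃ - Cε = -θ, the form required by `DesignLMI.quadratic_le`; likewise for θ̃ below.
-/
theorem errorSystem_flow_ε (x : HState nz ny) (w : Vec nw) :
    ((P.errorSystem L H T₁ T₂).flow x w).ε = P.A *ᵥ x.ε + L *ᵥ (x.θ - P.C *ᵥ x.ε) +
      P.B *ᵥ P.zeta x.z x.ε + P.N *ᵥ w.ofLp := by
  have h : ((P.errorSystem L H T₁ T₂).flow x w).ε = fun i =>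
    (P.calF L H *ᵥ x.err + P.calQ *ᵥ P.zeta x.z x.ε + P.calT *ᵥ w.ofLp) (Sum.inl i) := rfl
  rw [h, HState.err_eq, calF, calQ, calT, fromBlocks_mulVec, fromRows_mulVec, fromRows_mulVec]
  ext i
  simp [Matrix.sub_mulVec, mulVec_sub, ← mulVec_mulVec]
  ring

theorem errorSystem_flow_θ (x : HState nz ny) (w : Vec nw) :
    ((P.errorSystem L H T₁ T₂).flow x w).θ = P.C *ᵥ ((P.errorSystem L H T₁ T₂).flow x w).ε +
      H *ᵥ (x.θ - P.C *ᵥ x.ε) := by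
  have h : ((P.errorSystem L H T₁ T₂).flow x w).θ = fun i =>
    (P.calF L H *ᵥ x.err + P.calQ *ᵥ P.zeta x.z x.ε + P.calT *ᵥ w.ofLp) (Sum.inr i) := rfl
  rw [h, errorSystem_flow_ε, HState.err_eq, calF, calQ, calT, fromBlocks_mulVec, fromRows_mulVec,
    fromRows_mulVec]
  ext i
  simp [Matrix.sub_mulVec, Matrix.add_mulVec, mulVec_sub, mulVec_add, ← mulVec_mulVec]
  ring

variable {P} in
theorem norm_zeta_le {ℓ : ℝ} (hψ : ∀ v₁ v₂, ‖P.ψ v₁ - P.ψ v₂‖ ≤ ℓ * ‖v₁ - v₂‖)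
    (v₁ v₂ : Fin nz → ℝ) :
    ‖(WithLp.toLp 2 (P.zeta v₁ v₂) : Vec ns)‖ ≤ ℓ * ‖(WithLp.toLp 2 (P.S *ᵥ v₂) : Vec nq)‖ := by
  refine (hψ (WithLp.toLp 2 (P.S *ᵥ v₁)) (WithLp.toLp 2 (P.S *ᵥ (v₁ - v₂)))).trans (le_of_eq ?_)
  rw [← WithLp.toLp_sub, ← mulVec_sub, sub_sub_cancel]

variable {P} in
theorem zeta_dotProduct_le {ℓ : ℝ} (hψ : ∀ v₁ v₂, ‖P.ψ v₁ - P.ψ v₂‖ ≤ ℓ * ‖v₁ - v₂‖)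
    (v₁ v₂ : Fin nz → ℝ) :
    P.zeta v₁ v₂ ⬝ᵥ P.zeta v₁ v₂ ≤ ℓ ^ 2 * ((P.S *ᵥ v₂) ⬝ᵥ (P.S *ᵥ v₂)) := by
  rw [dotProduct_self_eq_norm_sq, dotProduct_self_eq_norm_sq, ← mul_pow]
  exact pow_le_pow_left₀ (norm_nonneg _) (norm_zeta_le hψ v₁ v₂) 2

/-- The jump keeps ε and sets θ̃ to -η. The old θ̃-term is nonnegative and dropped; the new one has
weight at most e^{δT₂}. -/
theorem jump_lyap_le (P₁ : Matrix (Fin nz) (Fin nz) ℝ) {P₂ : Matrix (Fin ny) (Fin ny) ℝ}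
    {δ : ℝ} (hδ : 0 < δ) (hP₂ : P₂.PosDef) :
    ∃ p > 0, ∀ (x g : HState nz ny) (η : Vec ny), x ∈ (P.errorSystem L H T₁ T₂).jumpSet →
      g ∈ (P.errorSystem L H T₁ T₂).jump x η →
      g.lyap P₁ P₂ δ ≤ x.lyap P₁ P₂ δ + p * ‖η‖ ^ 2 := by
  obtain ⟨K, hK, h⟩ := exists_quadratic_le P₂
  refine ⟨Real.exp (δ * T₂) * K, by positivity, ?_⟩
  rintro x g η hx ⟨v, hv, rfl⟩
  have hx' : x.τ = 0 := hx
  set g : HState nz ny := HState.mk x.z (calG nz ny *ᵥ x.err + calN nz ny *ᵥ η.ofLp) v with hg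
  have hε : g.ε = x.ε := by
    have : g.ε = fun i => (calG nz ny *ᵥ x.err + calN nz ny *ᵥ η.ofLp) (Sum.inl i) := rfl
    rw [this, HState.err_eq, calG, calN, fromBlocks_mulVec, fromRows_mulVec]
    ext i
    simp
  have hθ : g.θ = -η.ofLp := by
    have : g.θ = fun i => (calG nz ny *ᵥ x.err + calN nz ny *ᵥ η.ofLp) (Sum.inr i) := rfl
    rw [this, HState.err_eq, calG, calN, fromBlocks_mulVec, fromRows_mulVec]
    ext i
    simp [Matrix.neg_mulVec]
  have hτ : g.τ = v := rfl
  rw [HState.lyap, HState.lyap, hε, hθ, hτ, mulVec_neg, neg_dotProduct, dotProduct_neg, neg_neg]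
  have h1 := h η.ofLp
  rw [dotProduct_self_eq_norm_sq] at h1
  have h2 : 0 ≤ x.θ ⬝ᵥ (P₂ *ᵥ x.θ) := by
    simpa using hP₂.posSemidef.dotProduct_mulVec_nonneg x.θ
  have h3 : Real.exp (δ * v) ≤ Real.exp (δ * T₂) := Real.exp_le_exp.2 (by gcongr; exact hv.2)
  have h4 : Real.exp (δ * v) * (η.ofLp ⬝ᵥ (P₂ *ᵥ η.ofLp)) ≤
      Real.exp (δ * T₂) * (K * ‖η‖ ^ 2) :=
    (mul_le_mul_of_nonneg_left h1 (Real.exp_pos _).le).trans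
      (mul_le_mul_of_nonneg_right h3 (by positivity))
  have h5 : 0 ≤ Real.exp (δ * x.τ) * (x.θ ⬝ᵥ (P₂ *ᵥ x.θ)) := by positivity
  linarith

end ErrorDynamics

/-! ## Solution pairs of the error system: the timer -/

section Timer

variable {P : Plant nz ny nw nq ns np} {L : Matrix (Fin nz) (Fin ny) ℝ}
  {H : Matrix (Fin ny) (Fin ny) ℝ} {T₁ T₂ : ℝ} {E : Set (ℝ × ℕ)} {t : ℕ → ℝ}
  {φ : ℝ → ℕ → HState nz ny} {w : ℝ → ℕ → Vec nw} {η : ℝ → ℕ → Vec ny}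

theorem locallyLipschitz_τ : LocallyLipschitz (HState.τ : HState nz ny → ℝ) :=
  (EuclideanSpace.proj (𝕜 := ℝ)
    (Sum.inr (Sum.inr ()) : Fin nz ⊕ ((Fin nz ⊕ Fin ny) ⊕ Unit))).lipschitz.locallyLipschitz

theorem τ_eq_of_ae_hasDerivAt {f : ℝ → HState nz ny} {r s : ℝ} (hrs : r ≤ s)
    (hf : AbsolutelyContinuousOnInterval f r s)
    (hd : ∀ᵐ x ∂(volume.restrict (Icc r s)), HasDerivAt (fun s => (f s).τ) (-1) x) :
    (f s).τ = (f r).τ - (s - r) := by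
  have hac := hf.comp_locallyLipschitz locallyLipschitz_τ
  have h1 := hac.sub_le_mul hrs (M := -1) (hd.mono fun x hx => ⟨hx, le_rfl⟩)
  have h2 := hac.neg.sub_le_mul hrs (M := 1) (f' := fun _ => 1)
    (hd.mono fun x hx => ⟨by simpa using hx.neg, le_rfl⟩)
  simp only [Pi.neg_apply] at h2
  linarith

theorem timer_eq (h : IsSolutionPair (P.errorSystem L H T₁ T₂) E φ w η) (hE : HasJumpTimes E t)
    {r s : ℝ} {j : ℕ} (hr : t j ≤ r) (hrs : r ≤ s) (hs : (s, j) ∈ E) :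
    (φ s j).τ = (φ r j).τ - (s - r) := by
  refine τ_eq_of_ae_hasDerivAt hrs (h.absolutelyContinuous hE hr hrs hs) ?_
  filter_upwards [h.ae_flow hE hr hs] with x hx
  exact HState.hasDerivAt_apply hx.2 _

theorem timer_start_mem (hT₁ : 0 < T₁) (hT₁₂ : T₁ ≤ T₂)
    (h : IsSolutionPair (P.errorSystem L H T₁ T₂) E φ w η)
    (hE : HasJumpTimes E t) {s : ℝ} {j : ℕ} (hs : (s, j) ∈ E) : (φ (t j) j).τ ∈ Icc 0 T₂ := by
  cases j with
  | zero =>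
    rw [hE.zero]
    rcases h.initial with h0 | h0
    · exact h0
    · have : (φ 0 0).τ = 0 := h0
      rw [this]
      exact ⟨le_rfl, hT₁.le.trans hT₁₂⟩
  | succ j =>
    obtain ⟨v, hv, hg⟩ := (h.jump hE hs).2
    rw [hg]
    exact ⟨hT₁.le.trans hv.1, hv.2⟩

/-- Flows stay in the flow set only almost everywhere, so nonnegativity of the timer at every time
needs proof: a negative value would persist backwards on an interval of positive measure. -/
theorem timer_mem (hT₁ : 0 < T₁) (hT₁₂ : T₁ ≤ T₂)
    (h : IsSolutionPair (P.errorSystem L H T₁ T₂) E φ w η)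
    (hE : HasJumpTimes E t) {s : ℝ} {j : ℕ} (hs : (s, j) ∈ E) : (φ s j).τ ∈ Icc 0 T₂ := by
  have h0 := timer_start_mem hT₁ hT₁₂ h hE hs
  have h1 := timer_eq h hE le_rfl (hE.le hs) hs
  have h2 := hE.le hs
  refine ⟨?_, by linarith [h0.2]⟩
  by_contra! hneg
  have hpos : 0 < -(φ s j).τ := by linarith
  have hsub : t j < s := by linarith [h0.1]
  -- At a time x of the slice with x ≤ s the timer is τ(s) + (s - x), negative exactly for x > s +
  -- τ(s).
  set r := max (t j) (s + (φ s j).τ) with hr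
  have hrs : r < s := max_lt hsub (by linarith)
  have hae := h.ae_flow hE (le_max_left _ _ : t j ≤ r) hs
  have hne : (ae (volume.restrict (Ioo r s))).NeBot := by
    rw [ae_neBot, Ne, Measure.restrict_eq_zero]
    simp [hrs]
  obtain ⟨x, ⟨hx, -⟩, hx2⟩ := ((ae_restrict_of_ae_restrict_of_subset Ioo_subset_Icc_self hae).and
    (ae_restrict_mem measurableSet_Ioo)).exists
  have hx0 : 0 ≤ (φ x j).τ := hx.1
  have h3 := timer_eq h hE ((le_max_left _ _).trans hx2.1.le) hx2.2.le hs
  have h4 : s + (φ s j).τ < x := (le_max_right _ _).trans_lt hx2.1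
  linarith

/-- Each jump resets the timer to at least T₁, and it must reach 0 before the next one. The interval
before the first jump is exempt, as the initial timer value may be small. -/
theorem dwell_time (h : IsSolutionPair (P.errorSystem L H T₁ T₂) E φ w η)
    (hE : HasJumpTimes E t) {s : ℝ} {j : ℕ} (hs : (s, j + 2) ∈ E) :
    T₁ ≤ t (j + 2) - t (j + 1) := by
  have hend := hE.end_mem hs
  have h1 := timer_eq h hE le_rfl (hE.mono (Nat.le_succ (j + 1))) hend
  have h2 : (φ (t (j + 2)) (j + 1)).τ = 0 := (h.jump hE hs).1
  obtain ⟨v, hv, hg⟩ := (h.jump hE hend).2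
  have h3 : (φ (t (j + 1)) (j + 1)).τ = v := by rw [hg]; rfl
  have h4 := hv.1
  rw [show (j + 1).succ = j + 2 from rfl] at h1
  linarith

theorem counter_le (hT₁ : 0 < T₁) (h : IsSolutionPair (P.errorSystem L H T₁ T₂) E φ w η)
    (hE : HasJumpTimes E t) {s : ℝ} {j : ℕ} (hs : (s, j) ∈ E) : T₁ * j ≤ s + T₁ := by
  -- The first jump may come at once, so j + 1 jumps guarantee only j full dwell times; hence the
  -- extra T₁ in the bound.
  have key : ∀ j s, (s, j + 1) ∈ E → T₁ * j ≤ t (j + 1) := by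
    intro j
    induction j with
    | zero =>
      intro s hs
      simpa using hE.zero ▸ hE.mono (Nat.zero_le 1)
    | succ j ih =>
      intro s hs
      have h1 := ih _ (hE.end_mem hs)
      have h2 := dwell_time h hE hs
      push_cast
      rw [show j + 1 + 1 = j + 2 from rfl]
      linarith
  cases j with
  | zero => simpa using (hE.nonneg hs).trans (by linarith)
  | succ j =>
    have h1 := key j s hs
    have h2 := hE.le hs
    push_cast
    linarith

end Timer

/-! ## Dissipation along flows -/

section Dissipation

variable {P : Plant nz ny nw nq ns np} {ℓ T₁ T₂ lam γ δ χ : ℝ}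
  {P₁ X : Matrix (Fin nz) (Fin nz) ℝ} {P₂ U W : Matrix (Fin ny) (Fin ny) ℝ}
  {J : Matrix (Fin nz) (Fin ny) ℝ} {E : Set (ℝ × ℕ)} {t : ℕ → ℝ}
  {φ : ℝ → ℕ → HState nz ny} {w : ℝ → ℕ → Vec nw} {η : ℝ → ℕ → Vec ny}

theorem ae_dissipation (hψ : ∀ v₁ v₂, ‖P.ψ v₁ - P.ψ v₂‖ ≤ ℓ * ‖v₁ - v₂‖)
    (hP₁ : P₁.PosDef) (hP₂ : P₂.PosDef) (hδ : 0 < δ) (hχ : 0 < χ)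
    (hLMI : P.DesignLMI ℓ T₂ lam γ δ χ P₁ X P₂ U W J)
    (h : IsSolutionPair (P.errorSystem (Xᵀ⁻¹ * J) (Uᵀ⁻¹ * W) T₁ T₂) E φ w η)
    (hE : HasJumpTimes E t) {r s : ℝ} {j : ℕ} (hr : t j ≤ r) (hs : (s, j) ∈ E) :
    ∃ V' : ℝ → ℝ, ∀ᵐ x ∂(volume.restrict (Icc r s)),
      HasDerivAt (fun s => (φ s j).lyap P₁ P₂ δ) (V' x) x ∧
      V' x ≤ -(2 * lam) * (φ x j).lyap P₁ P₂ δ - ‖P.perfOutput (φ x j)‖ ^ 2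
        + γ ^ 2 * ‖w x j‖ ^ 2 := by
  have hS₁ : P₁.IsSymm := hP₁.isHermitian
  have hS₂ : P₂.IsSymm := hP₂.isHermitian
  refine ⟨_, (h.ae_flow hE hr hs).mono fun x hx => ⟨HState.hasDerivAt_lyap
    hS₁ hS₂ hx.2 (errorSystem_flow_τ ..), ?_⟩⟩
  have hτ : (φ x j).τ ∈ Icc 0 T₂ := hx.1
  have he : Real.exp (δ * (φ x j).τ) ∈ Icc 1 (Real.exp (δ * T₂)) :=
    ⟨Real.one_le_exp (mul_nonneg hδ.le hτ.1), Real.exp_le_exp.2 (by gcongr; exact hτ.2)⟩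
  have key := hLMI.quadratic_le he
    (errorSystem_flow_ε P (Xᵀ⁻¹ * J) (Uᵀ⁻¹ * W) T₁ T₂ (φ x j) (w x j))
    (errorSystem_flow_θ P (Xᵀ⁻¹ * J) (Uᵀ⁻¹ * W) T₁ T₂ (φ x j) (w x j))
  -- S-procedure: the Lipschitz bound gives the χ-term the sign that lets it be dropped.
  have hζ := mul_nonneg hχ.le (sub_nonneg.2 (zeta_dotProduct_le hψ (φ x j).z (φ x j).ε))
  rw [dotProduct_self_eq_norm_sq (P.Cp *ᵥ _), dotProduct_self_eq_norm_sq (w x j).ofLp] at key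
  simp only [HState.lyap, perfOutput]
  linarith

end Dissipation

end Plant

namespace Plant

variable {nz ny nw nq ns np : ℕ}

/-! ## Exponential bounds -/

section Bounds

variable {P : Plant nz ny nw nq ns np} {ℓ T₁ T₂ lam γ δ χ : ℝ}
  {P₁ X : Matrix (Fin nz) (Fin nz) ℝ} {P₂ U W : Matrix (Fin ny) (Fin ny) ℝ}
  {J : Matrix (Fin nz) (Fin ny) ℝ}

theorem exists_lyap_le_exp (hT₁ : 0 < T₁) (hlam : 0 < lam) (hγ : 0 < γ)
    (hψ : ∀ v₁ v₂, ‖P.ψ v₁ - P.ψ v₂‖ ≤ ℓ * ‖v₁ - v₂‖)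
    (hP₁ : P₁.PosDef) (hP₂ : P₂.PosDef) (hδ : 0 < δ) (hχ : 0 < χ)
    (hLMI : P.DesignLMI ℓ T₂ lam γ δ χ P₁ X P₂ U W J) :
    ∃ D > 0, ∀ E t φ w η, IsSolutionPair (P.errorSystem (Xᵀ⁻¹ * J) (Uᵀ⁻¹ * W) T₁ T₂) E φ w η →
      HasJumpTimes E t → ∀ μ : ℝ,
      (∀ j, ∀ᵐ s ∂(volume.restrict (timeSlice E j)), ‖w s j‖ ≤ μ) →
      (∀ s j, (s, j) ∈ jumpPoints E → ‖η s j‖ ≤ μ) → ∀ s j, (s, j) ∈ E →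
      (φ s j).lyap P₁ P₂ δ ≤
        Real.exp (-(2 * lam) * s) * (φ 0 0).lyap P₁ P₂ δ + D * μ ^ 2 := by
  obtain ⟨p, hp, hjump⟩ := jump_lyap_le P (Xᵀ⁻¹ * J) (Uᵀ⁻¹ * W) T₁ T₂ P₁ hδ hP₂
  set q := Real.exp (-(2 * lam) * T₁) with hq
  have hq1 : 0 < 1 - q := by
    have : q < 1 := Real.exp_lt_one_iff.2 (by nlinarith)
    linarith
  -- With |w| ≤ μ, dissipation reads V' ≤ -2λ_t(V - Gμ²).
  set G := γ ^ 2 / (2 * lam) with hG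
  have hGpos : 0 < G := by positivity
  -- R is the fixed point of R = qR + p: between later jumps the accumulated jump contribution
  -- contracts by q, and each jump adds p.
  set R := p / (1 - q) with hR
  have hRpos : 0 < R := by positivity
  have hRq : q * R + p = R := by rw [hR]; field_simp; ring
  have hpR : p ≤ R := by
    have : 0 ≤ q * R := mul_nonneg (Real.exp_pos _).le hRpos.le
    linarith
  refine ⟨G + R, by positivity, fun E t φ w η h hE μ hw hη => ?_⟩
  set V : ℝ → ℕ → ℝ := fun s j => (φ s j).lyap P₁ P₂ δ with hV
  have hflow : ∀ s j, (s, j) ∈ E →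
      V s j ≤ Real.exp (-(2 * lam) * (s - t j)) * (V (t j) j - G * μ ^ 2) + G * μ ^ 2 := by
    intro s j hs
    obtain ⟨V', hV'⟩ := ae_dissipation hψ hP₁ hP₂ hδ hχ hLMI h hE le_rfl hs
    refine ((h.absolutelyContinuous hE le_rfl (hE.le hs) hs).comp_locallyLipschitz
      HState.locallyLipschitz_lyap).le_exp_mul_add (hE.le hs) (f' := V') ?_
    filter_upwards [hV', ae_restrict_of_ae_restrict_of_subset (hE.Icc_subset le_rfl hs) (hw j)]
      with x hx hwx
    refine ⟨hx.1, hx.2.trans ?_⟩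
    have h1 : ‖w x j‖ ^ 2 ≤ μ ^ 2 := pow_le_pow_left₀ (norm_nonneg _) hwx 2
    have h2 := mul_le_mul_of_nonneg_left h1 (sq_nonneg γ)
    have h3 : 2 * lam * (G * μ ^ 2) = γ ^ 2 * μ ^ 2 := by rw [hG]; field_simp
    nlinarith [sq_nonneg ‖P.perfOutput (φ x j)‖]
  have hexp : ∀ a b : ℝ, Real.exp (-(2 * lam) * (b - a)) * Real.exp (-(2 * lam) * a) =
      Real.exp (-(2 * lam) * b) := fun a b => by rw [← Real.exp_add]; ring_nf
  have hle1 : ∀ s j, (s, j) ∈ E → Real.exp (-(2 * lam) * (s - t j)) ≤ 1 := fun s j hs =>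
    Real.exp_le_one_iff.2 (by nlinarith [hE.le hs])
  have hstart : ∀ j s, (s, j) ∈ E →
      V (t j) j ≤ Real.exp (-(2 * lam) * t j) * V 0 0 + (G + R) * μ ^ 2 := by
    intro j
    induction j with
    | zero =>
      intro s _
      rw [hE.zero]
      simp only [mul_zero, Real.exp_zero, one_mul, le_add_iff_nonneg_right]
      positivity
    | succ j ih =>
      intro s hs
      have hend := hE.end_mem hs
      have h1 := hjump _ _ _ (h.jump hE hs).1 (h.jump hE hs).2
      have h2 : ‖η (t (j + 1)) j‖ ^ 2 ≤ μ ^ 2 :=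
        pow_le_pow_left₀ (norm_nonneg _) (hη _ _ (hE.jump_mem hs)) 2
      have h3 : V (t (j + 1)) (j + 1) ≤ V (t (j + 1)) j + p * μ ^ 2 :=
        h1.trans (by gcongr)
      -- Before the first jump no dwell time is available, but nothing has accumulated yet and p ≤ R
      -- suffices. Afterwards the Gμ² parts cancel and qR + p = R closes the induction.
      have h4 := hflow _ _ hend
      cases j with
      | zero =>
        simp only [hE.zero, sub_zero] at h4
        have h5 : 0 ≤ Real.exp (-(2 * lam) * t (0 + 1)) * (G * μ ^ 2) := by positivity
        nlinarith [mul_le_mul_of_nonneg_right hpR (sq_nonneg μ)]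
      | succ i =>
        have h5 := dwell_time h hE hs
        have h6 : Real.exp (-(2 * lam) * (t (i + 1 + 1) - t (i + 1))) ≤ q :=
          Real.exp_le_exp.2 (by
            rw [show i + 1 + 1 = i + 2 from rfl]
            nlinarith)
        have h7 := mul_le_mul_of_nonneg_left (ih _ hend)
          (Real.exp_pos (-(2 * lam) * (t (i + 1 + 1) - t (i + 1)))).le
        rw [mul_add, ← mul_assoc, hexp] at h7
        have h8 := mul_le_mul_of_nonneg_right h6 (by positivity : 0 ≤ R * μ ^ 2)
        have h9 : q * (R * μ ^ 2) + p * μ ^ 2 = R * μ ^ 2 := by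
          linear_combination μ ^ 2 * hRq
        linarith
  intro s j hs
  have h1 := hflow s j hs
  have h2 := mul_le_mul_of_nonneg_left (hstart j s hs) (Real.exp_pos (-(2 * lam) * (s - t j))).le
  rw [mul_add, ← mul_assoc, hexp] at h2
  have h3 := mul_le_mul_of_nonneg_right (hle1 s j hs) (by positivity : 0 ≤ R * μ ^ 2)
  linarith

theorem exists_infDist_le (hT₁ : 0 < T₁) (hT₁₂ : T₁ ≤ T₂) (hlam : 0 < lam) (hγ : 0 < γ)
    (hψ : ∀ v₁ v₂, ‖P.ψ v₁ - P.ψ v₂‖ ≤ ℓ * ‖v₁ - v₂‖)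
    (hP₁ : P₁.PosDef) (hP₂ : P₂.PosDef) (hδ : 0 < δ) (hχ : 0 < χ)
    (hLMI : P.DesignLMI ℓ T₂ lam γ δ χ P₁ X P₂ U W J) :
    ∃ κ > 0, ∃ D > 0, ∃ rate > 0, ∀ E φ w η,
      IsSolutionPair (P.errorSystem (Xᵀ⁻¹ * J) (Uᵀ⁻¹ * W) T₁ T₂) E φ w η → ∀ μ : ℝ, 0 ≤ μ →
      (∀ j, ∀ᵐ s ∂(volume.restrict (timeSlice E j)), ‖w s j‖ ≤ μ) →
      (∀ s j, (s, j) ∈ jumpPoints E → ‖η s j‖ ≤ μ) → ∀ s j, (s, j) ∈ E →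
      Metric.infDist (φ s j) (attractor nz ny T₂) ≤
        κ * Real.exp (-lam * s) * Metric.infDist (φ 0 0) (attractor nz ny T₂) + D * μ ∧
      Metric.infDist (φ s j) (attractor nz ny T₂) ≤
        κ * Real.exp (-rate * (s + j)) * Metric.infDist (φ 0 0) (attractor nz ny T₂) + D * μ := by
  obtain ⟨D, hD, hbound⟩ := exists_lyap_le_exp (T₁ := T₁) hT₁ hlam hγ hψ hP₁ hP₂ hδ hχ hLMI
  obtain ⟨m, hm, hlow⟩ := HState.exists_le_lyap (nz := nz) (ny := ny) hP₁ hP₂ hδ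
  obtain ⟨M, hM, hup⟩ := HState.exists_lyap_le P₁ P₂ hδ T₂
  -- From T₁ j ≤ s + T₁ one gets r(s + j) ≤ λ_t s + r, so e^{-λ_t s} ≤ e^r e^{-r(s + j)}. This
  -- explains the factor e^r in κ.
  set r := lam * T₁ / (1 + T₁) with hr
  have hrpos : 0 < r := by positivity
  refine ⟨√(M / m) * Real.exp r, by positivity, √(D / m), by positivity, r, hrpos,
    fun E φ w η h μ hμ hw hη s j hs => ?_⟩
  obtain ⟨t, hE⟩ := h.timeDomain.exists_hasJumpTimes
  have hτ := timer_mem hT₁ hT₁₂ h hE hs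
  have hτ0 := timer_mem hT₁ hT₁₂ h hE hE.origin
  rw [HState.infDist_attractor hτ, HState.infDist_attractor hτ0]
  have h1 := hbound E t φ w η h hE μ hw hη s j hs
  have h2 := hlow _ hτ.1
  have h3 := hup _ hτ0.2
  set e := (φ s j).errNorm
  set e₀ := (φ 0 0).errNorm
  have he : 0 ≤ e := HState.errNorm_nonneg _
  have he₀ : 0 ≤ e₀ := HState.errNorm_nonneg _
  have key : e ≤ √(M / m) * Real.exp (-lam * s) * e₀ + √(D / m) * μ := by
    refine abs_le_of_sq_le_sq' ?_ (by positivity) |>.2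
    have h4 : e ^ 2 ≤ (M / m) * (Real.exp (-lam * s)) ^ 2 * e₀ ^ 2 + (D / m) * μ ^ 2 := by
      have h5 : Real.exp (-(2 * lam) * s) = (Real.exp (-lam * s)) ^ 2 := by
        rw [← Real.exp_nat_mul]; congr 1; push_cast; ring
      rw [h5] at h1
      have h6 := mul_le_mul_of_nonneg_left h3 (sq_nonneg (Real.exp (-lam * s)))
      have h7 : m * ((M / m) * (Real.exp (-lam * s)) ^ 2 * e₀ ^ 2 + (D / m) * μ ^ 2) =
          (Real.exp (-lam * s)) ^ 2 * (M * e₀ ^ 2) + D * μ ^ 2 := by field_simp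
      refine le_of_mul_le_mul_left ?_ hm
      rw [h7]
      linarith
    have h8 : (√(M / m) * Real.exp (-lam * s) * e₀) ^ 2 =
        (M / m) * (Real.exp (-lam * s)) ^ 2 * e₀ ^ 2 := by
      rw [mul_pow, mul_pow, Real.sq_sqrt (by positivity)]
    have h9 : (√(D / m) * μ) ^ 2 = (D / m) * μ ^ 2 := by
      rw [mul_pow, Real.sq_sqrt (by positivity)]
    have h10 : 0 ≤ (√(M / m) * Real.exp (-lam * s) * e₀) * (√(D / m) * μ) := by positivity
    nlinarith
  have hcount := counter_le hT₁ h hE hs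
  have hexp : Real.exp (-lam * s) ≤ Real.exp r * Real.exp (-r * (s + j)) := by
    rw [← Real.exp_add]
    refine Real.exp_le_exp.2 ?_
    have h4 : r * (1 + T₁) = lam * T₁ := by rw [hr]; field_simp
    have h5 : T₁ * (r * (s + j)) ≤ T₁ * (lam * s + r) := by
      calc T₁ * (r * (s + j)) = r * (T₁ * s + T₁ * j) := by ring
        _ ≤ r * (T₁ * s + (s + T₁)) := by gcongr
        _ = r * (1 + T₁) * s + r * T₁ := by ring
        _ = T₁ * (lam * s + r) := by rw [h4]; ring
    have := le_of_mul_le_mul_left h5 hT₁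
    linarith
  refine ⟨key.trans ?_, key.trans ?_⟩
  · gcongr
    exact le_mul_of_one_le_right (Real.sqrt_nonneg _) (Real.one_le_exp hrpos.le)
  · rw [mul_assoc √(M / m) (Real.exp r)]
    gcongr

end Bounds

end Plant

namespace Plant

variable {nz ny nw nq ns np : ℕ}

/-! ## The `L²` gain -/

section Gain

variable {P : Plant nz ny nw nq ns np} {ℓ T₁ T₂ lam γ δ χ : ℝ}
  {P₁ X : Matrix (Fin nz) (Fin nz) ℝ} {P₂ U W : Matrix (Fin ny) (Fin ny) ℝ}
  {J : Matrix (Fin nz) (Fin ny) ℝ} {E : Set (ℝ × ℕ)} {t : ℕ → ℝ}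
  {φ : ℝ → ℕ → HState nz ny} {w : ℝ → ℕ → Vec nw} {η : ℝ → ℕ → Vec ny}

theorem lintegral_enorm_sq_eq {V : Type*} [NormedAddCommGroup V] {f : ℝ → V} {s : Set ℝ}
    (hf : IntegrableOn (fun x => ‖f x‖ ^ 2) s) :
    ∫⁻ x in s, ‖f x‖ₑ ^ (2 : ℝ) = ENNReal.ofReal (∫ x in s, ‖f x‖ ^ 2) := by
  rw [ofReal_integral_eq_lintegral_ofReal hf (ae_of_all _ fun x => sq_nonneg _)]
  refine lintegral_congr fun x => ?_
  rw [← ofReal_norm, ENNReal.ofReal_rpow_of_nonneg (norm_nonneg _) (by norm_num), Real.rpow_two]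

theorem continuous_perfOutput : Continuous (P.perfOutput : HState nz ny → Vec np) := by
  unfold perfOutput HState.ε HState.err mulVec dotProduct
  fun_prop

/-- The dissipation inequality is integrated after dropping -2λ_t V ≤ 0. It is arranged without
subtraction so that it can be summed in [0, ∞]; the integrals are finite because the slice portion
is compact. -/
theorem slice_gain (hT₁ : 0 < T₁) (hT₁₂ : T₁ ≤ T₂) (hlam : 0 < lam)
    (hψ : ∀ v₁ v₂, ‖P.ψ v₁ - P.ψ v₂‖ ≤ ℓ * ‖v₁ - v₂‖)
    (hP₁ : P₁.PosDef) (hP₂ : P₂.PosDef) (hδ : 0 < δ) (hχ : 0 < χ)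
    (hLMI : P.DesignLMI ℓ T₂ lam γ δ χ P₁ X P₂ U W J)
    (h : IsSolutionPair (P.errorSystem (Xᵀ⁻¹ * J) (Uᵀ⁻¹ * W) T₁ T₂) E φ w η)
    (hE : HasJumpTimes E t) {s : ℝ} {j : ℕ} (hs : (s, j) ∈ E) :
    (∫⁻ x in Ioc (t j) s, ‖P.perfOutput (φ x j)‖ₑ ^ (2 : ℝ)) +
        ENNReal.ofReal ((φ s j).lyap P₁ P₂ δ) ≤
      ENNReal.ofReal ((φ (t j) j).lyap P₁ P₂ δ) +
        ENNReal.ofReal (γ ^ 2) * ∫⁻ x in Ioc (t j) s, ‖w x j‖ₑ ^ (2 : ℝ) := by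
  have hts := hE.le hs
  have hnonneg : ∀ x, (x, j) ∈ E → 0 ≤ (φ x j).lyap P₁ P₂ δ := by
    obtain ⟨m, hm, hlow⟩ := HState.exists_le_lyap (nz := nz) (ny := ny) hP₁ hP₂ hδ
    intro x hx
    exact (by positivity : 0 ≤ m * (φ x j).errNorm ^ 2).trans
      (hlow _ (timer_mem hT₁ hT₁₂ h hE hx).1)
  have hac := h.absolutelyContinuous hE le_rfl hts hs
  have hsub := hE.Icc_subset le_rfl hs
  have hy : IntegrableOn (fun x => ‖P.perfOutput (φ x j)‖ ^ 2) (Icc (t j) s) := by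
    have := hac.continuousOn
    rw [uIcc_of_le hts] at this
    exact ((continuous_perfOutput.comp_continuousOn this).norm.pow 2).integrableOn_Icc
  have hw : IntegrableOn (fun x => ‖w x j‖ ^ 2) (Icc (t j) s) := by
    obtain ⟨h1, h2⟩ := h.input_w j
    obtain ⟨M, hM⟩ := h2 _ isCompact_Icc hsub
    refine Integrable.of_bound
      ((h1.mono_measure (Measure.restrict_mono hsub le_rfl)).norm.pow 2) (M ^ 2) ?_
    filter_upwards [hM] with x hx
    simp only [norm_pow, norm_norm]
    exact pow_le_pow_left₀ (norm_nonneg _) hx 2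
  obtain ⟨V', hV'⟩ := ae_dissipation hψ hP₁ hP₂ hδ hχ hLMI h hE le_rfl hs
  have hyI : IntervalIntegrable (fun x => ‖P.perfOutput (φ x j)‖ ^ 2) volume (t j) s :=
    (intervalIntegrable_iff_integrableOn_Icc_of_le hts).2 hy
  have hwI : IntervalIntegrable (fun x => ‖w x j‖ ^ 2) volume (t j) s :=
    (intervalIntegrable_iff_integrableOn_Icc_of_le hts).2 hw
  have key := (hac.comp_locallyLipschitz
    (HState.locallyLipschitz_lyap (P₁ := P₁) (P₂ := P₂) (δ := δ))).sub_le_integral hts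
    (f' := V') (g := fun x => γ ^ 2 * ‖w x j‖ ^ 2 - ‖P.perfOutput (φ x j)‖ ^ 2) (by
      filter_upwards [hV', ae_restrict_mem measurableSet_Icc] with x hx hxm
      refine ⟨hx.1, hx.2.trans ?_⟩
      have := mul_nonneg hlam.le (hnonneg x (hsub hxm))
      linarith) ((hwI.const_mul _).sub hyI)
  rw [intervalIntegral.integral_sub (hwI.const_mul _) hyI, intervalIntegral.integral_const_mul,
    intervalIntegral.integral_of_le hts, intervalIntegral.integral_of_le hts] at key
  rw [lintegral_enorm_sq_eq (hy.mono_set Ioc_subset_Icc_self),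
    lintegral_enorm_sq_eq (hw.mono_set Ioc_subset_Icc_self),
    ← ENNReal.ofReal_mul (sq_nonneg γ), ← ENNReal.ofReal_add, ← ENNReal.ofReal_add]
  · refine ENNReal.ofReal_le_ofReal ?_
    linarith
  · exact hnonneg _ (hE.start_mem hs)
  · exact mul_nonneg (sq_nonneg γ) (integral_nonneg fun x => sq_nonneg _)
  · exact integral_nonneg fun x => sq_nonneg _
  · exact hnonneg _ hs

theorem lintegral_Ioc_firstCounter (hE : HasJumpTimes E t) {s : ℝ} {j : ℕ} (hs : (s, j) ∈ E)
    (f : ℝ → ℕ → ℝ≥0∞) :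
    ∫⁻ x in Ioc 0 s, f x (firstCounter E x) =
      (∫⁻ x in Ioc 0 (t j), f x (firstCounter E x)) + ∫⁻ x in Ioc (t j) s, f x j := by
  rw [← Ioc_union_Ioc_eq_Ioc (hE.nonneg (hE.start_mem hs)) (hE.le hs),
    lintegral_union measurableSet_Ioc (Ioc_disjoint_Ioc_of_le le_rfl)]
  congr 1
  refine setLIntegral_congr_fun measurableSet_Ioc fun x hx => ?_
  simp only [hE.firstCounter_eq hs hx]

theorem ordinary_gain (hT₁ : 0 < T₁) (hT₁₂ : T₁ ≤ T₂) (hlam : 0 < lam)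
    (hψ : ∀ v₁ v₂, ‖P.ψ v₁ - P.ψ v₂‖ ≤ ℓ * ‖v₁ - v₂‖)
    (hP₁ : P₁.PosDef) (hP₂ : P₂.PosDef) (hδ : 0 < δ) (hχ : 0 < χ)
    (hLMI : P.DesignLMI ℓ T₂ lam γ δ χ P₁ X P₂ U W J)
    (h : IsSolutionPair (P.errorSystem (Xᵀ⁻¹ * J) (Uᵀ⁻¹ * W) T₁ T₂) E φ w η)
    (hη : ZeroOn E η) (hE : HasJumpTimes E t) {s : ℝ} {j : ℕ} (hs : (s, j) ∈ E) :
    (∫⁻ x in Ioc 0 s, ‖P.perfOutput (φ x (firstCounter E x))‖ₑ ^ (2 : ℝ)) +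
        ENNReal.ofReal ((φ s j).lyap P₁ P₂ δ) ≤
      ENNReal.ofReal ((φ 0 0).lyap P₁ P₂ δ) +
        ENNReal.ofReal (γ ^ 2) * ∫⁻ x in Ioc 0 s, ‖w x (firstCounter E x)‖ₑ ^ (2 : ℝ) := by
  have hstep : ∀ j s, (s, j) ∈ E →
      (∫⁻ x in Ioc 0 (t j), ‖P.perfOutput (φ x (firstCounter E x))‖ₑ ^ (2 : ℝ)) +
        ENNReal.ofReal ((φ (t j) j).lyap P₁ P₂ δ) ≤
      ENNReal.ofReal ((φ 0 0).lyap P₁ P₂ δ) +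
        ENNReal.ofReal (γ ^ 2) * ∫⁻ x in Ioc 0 (t j), ‖w x (firstCounter E x)‖ₑ ^ (2 : ℝ) →
      (∫⁻ x in Ioc 0 s, ‖P.perfOutput (φ x (firstCounter E x))‖ₑ ^ (2 : ℝ)) +
        ENNReal.ofReal ((φ s j).lyap P₁ P₂ δ) ≤
      ENNReal.ofReal ((φ 0 0).lyap P₁ P₂ δ) +
        ENNReal.ofReal (γ ^ 2) * ∫⁻ x in Ioc 0 s, ‖w x (firstCounter E x)‖ₑ ^ (2 : ℝ) := by
    intro j s hs hj
    rw [lintegral_Ioc_firstCounter hE hs fun x i => ‖P.perfOutput (φ x i)‖ₑ ^ (2 : ℝ),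
      lintegral_Ioc_firstCounter hE hs fun x i => ‖w x i‖ₑ ^ (2 : ℝ), add_assoc, mul_add,
      ← add_assoc (ENNReal.ofReal _)]
    refine (add_le_add_right
      (slice_gain hT₁ hT₁₂ hlam hψ hP₁ hP₂ hδ hχ hLMI h hE hs) _).trans ?_
    rw [← add_assoc]
    exact add_le_add_left hj _
  induction j generalizing s with
  | zero =>
    refine hstep 0 s hs ?_
    simp [hE.zero]
  | succ j ih =>
    refine hstep (j + 1) s hs (le_trans ?_ (ih (hE.end_mem hs)))
    obtain ⟨p, hp, hjump⟩ := jump_lyap_le P (Xᵀ⁻¹ * J) (Uᵀ⁻¹ * W) T₁ T₂ P₁ hδ hP₂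
    have h1 := hjump _ _ _ (h.jump hE hs).1 (h.jump hE hs).2
    -- Without measurement noise V does not increase at the jump.
    rw [hη _ _ (hE.end_mem hs)] at h1
    refine add_le_add_right (ENNReal.ofReal_le_ofReal ?_) _
    simpa using h1

/-- Monotone convergence along an exhaustion by compact intervals: estimates at each finite time
pass to the whole domain, even when the norm is infinite. -/
theorem l2Norm_eq_iSup {V : Type*} [NormedAddCommGroup V] (hE : HasJumpTimes E t)
    (u : ℝ → ℕ → V) :
    l2Norm E u = (⨆ s ∈ ordinaryTimes E,
      ∫⁻ x in Ioc 0 s, ‖u x (firstCounter E x)‖ₑ ^ (2 : ℝ)) ^ (1 / 2 : ℝ) := by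
  obtain ⟨x, hx, hmem, hU⟩ := hE.exists_monotone_iUnion
  rw [l2Norm, eLpNorm_eq_lintegral_rpow_enorm_toReal (by norm_num) (by norm_num),
    ENNReal.toReal_ofNat]
  congr 1
  have hIcc : ∀ s, ∫⁻ x in Icc 0 s, ‖u x (firstCounter E x)‖ₑ ^ (2 : ℝ) =
      ∫⁻ x in Ioc 0 s, ‖u x (firstCounter E x)‖ₑ ^ (2 : ℝ) := fun s =>
    setLIntegral_congr Ioc_ae_eq_Icc.symm
  refine le_antisymm ?_ (iSup₂_le fun s hs => ?_)
  · rw [hU, setLIntegral_iUnion_of_directed _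
      (Monotone.directed_le fun m n hmn => Icc_subset_Icc_right (hx hmn))]
    refine iSup_le fun n => ?_
    rw [hIcc, ← hU]
    exact le_iSup₂ (f := fun s (_ : s ∈ ordinaryTimes E) =>
      ∫⁻ x in Ioc 0 s, ‖u x (firstCounter E x)‖ₑ ^ (2 : ℝ)) (x n) (hmem n)
  · obtain ⟨j, hj⟩ := hs
    rw [← hIcc]
    exact lintegral_mono_set (hE.Icc_subset_ordinaryTimes hj)

theorem hasL2Gain (hT₁ : 0 < T₁) (hT₁₂ : T₁ ≤ T₂) (hlam : 0 < lam) (hγ : 0 < γ)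
    (hψ : ∀ v₁ v₂, ‖P.ψ v₁ - P.ψ v₂‖ ≤ ℓ * ‖v₁ - v₂‖)
    (hP₁ : P₁.PosDef) (hP₂ : P₂.PosDef) (hδ : 0 < δ) (hχ : 0 < χ)
    (hLMI : P.DesignLMI ℓ T₂ lam γ δ χ P₁ X P₂ U W J) :
    HasL2Gain (P.errorSystem (Xᵀ⁻¹ * J) (Uᵀ⁻¹ * W) T₁ T₂) (attractor nz ny T₂) P.perfOutput γ := by
  obtain ⟨M, hM, hup⟩ := HState.exists_lyap_le P₁ P₂ hδ T₂
  refine ⟨√M, by positivity, fun E φ w η h hη => ?_⟩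
  obtain ⟨t, hE⟩ := h.timeDomain.exists_hasJumpTimes
  have hτ0 := timer_mem hT₁ hT₁₂ h hE hE.origin
  rw [HState.infDist_attractor hτ0, l2Norm_eq_iSup hE, l2Norm_eq_iSup hE]
  set I := ⨆ s ∈ ordinaryTimes E, ∫⁻ x in Ioc 0 s, ‖w x (firstCounter E x)‖ₑ ^ (2 : ℝ) with hI
  have h1 : ⨆ s ∈ ordinaryTimes E,
      ∫⁻ x in Ioc 0 s, ‖P.perfOutput (φ x (firstCounter E x))‖ₑ ^ (2 : ℝ) ≤
      ENNReal.ofReal ((√M * (φ 0 0).errNorm) ^ 2) + ENNReal.ofReal (γ ^ 2) * I := by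
    refine iSup₂_le fun s hs => ?_
    obtain ⟨j, hj⟩ := hs
    refine le_self_add.trans ((ordinary_gain hT₁ hT₁₂ hlam hψ hP₁ hP₂ hδ hχ hLMI h hη hE hj).trans
      (add_le_add (ENNReal.ofReal_le_ofReal ?_) ?_))
    · rw [mul_pow, Real.sq_sqrt hM.le]
      exact hup _ hτ0.2
    · gcongr
      exact le_iSup₂ (f := fun s (_ : s ∈ ordinaryTimes E) =>
        ∫⁻ x in Ioc 0 s, ‖w x (firstCounter E x)‖ₑ ^ (2 : ℝ)) s ⟨j, hj⟩
  have hsqrt : ∀ a : ℝ, 0 ≤ a → ENNReal.ofReal (a ^ 2) ^ (1 / 2 : ℝ) = ENNReal.ofReal a :=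
    fun a ha => by
      rw [ENNReal.ofReal_rpow_of_nonneg (sq_nonneg a) (by norm_num), ← Real.sqrt_eq_rpow,
        Real.sqrt_sq ha]
  -- The square root is subadditive, so the squared bound splits and keeps the gain γ exactly.
  refine (ENNReal.rpow_le_rpow h1 (by norm_num)).trans
    ((ENNReal.rpow_add_le_add_rpow _ _ (by norm_num) (by norm_num)).trans (le_of_eq ?_))
  rw [ENNReal.mul_rpow_of_nonneg _ _ (by norm_num), hsqrt _ hγ.le,
    hsqrt _ (mul_nonneg (Real.sqrt_nonneg _) (HState.errNorm_nonneg _))]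

end Gain

end Plant

/-! ## Extension of solution pairs -/

open Classical in
/-- The signal `u`, set to zero outside `E`. -/
noncomputable def cutoff {V : Type*} [Zero V] (E : Set (ℝ × ℕ)) (u : ℝ → ℕ → V) : ℝ → ℕ → V :=
  fun t j => if (t, j) ∈ E then u t j else 0

theorem cutoff_of_mem {V : Type*} [Zero V] {E : Set (ℝ × ℕ)} (u : ℝ → ℕ → V) {t : ℝ} {j : ℕ}
    (h : (t, j) ∈ E) : cutoff E u t j = u t j := if_pos h

theorem cutoff_of_notMem {V : Type*} [Zero V] {E : Set (ℝ × ℕ)} (u : ℝ → ℕ → V) {t : ℝ} {j : ℕ}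
    (h : (t, j) ∉ E) : cutoff E u t j = 0 := if_neg h

theorem cutoff_zero {V : Type*} [Zero V] (E : Set (ℝ × ℕ)) : cutoff E (0 : ℝ → ℕ → V) = 0 := by
  ext t j
  simp [cutoff]

/-- When a slice grows, a compact subset of the new one may meet the old one in a noncompact set,
where local boundedness says nothing. Hence an essential bound is required on every slice that
changes. -/
theorem IsHybridInput.cutoff {V : Type*} [NormedAddCommGroup V] {E E' : Set (ℝ × ℕ)} {t : ℕ → ℝ}
    {u : ℝ → ℕ → V} (hu : IsHybridInput E u) (hE : HasJumpTimes E t)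
    (h : ∀ j, timeSlice E' j = timeSlice E j ∨
      ∃ M : ℝ, ∀ᵐ s ∂(volume.restrict (timeSlice E j)), ‖u s j‖ ≤ M) :
    IsHybridInput E' (cutoff E u) := by
  intro j
  have hmeas : MeasurableSet (timeSlice E j) := (hE.ordConnected_timeSlice j).measurableSet
  have hind : (fun s => _root_.cutoff E u s j) = (timeSlice E j).indicator fun s => u s j := by
    ext s
    by_cases hs : s ∈ timeSlice E j
    · rw [indicator_of_mem hs]; exact cutoff_of_mem u hs
    · rw [indicator_of_notMem hs]; exact cutoff_of_notMem u hs
  refine ⟨?_, fun K hK hKs => ?_⟩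
  · rw [hind]
    exact ((aestronglyMeasurable_indicator_iff hmeas).2 (hu j).1).restrict
  rcases h j with h | ⟨M, hM⟩
  · rw [h] at hKs
    obtain ⟨M, hM⟩ := (hu j).2 K hK hKs
    refine ⟨M, ?_⟩
    filter_upwards [hM, ae_restrict_mem hK.measurableSet] with s hs hsK
    rwa [cutoff_of_mem (E := E) u (hKs hsK)]
  · refine ⟨max M 0, ae_restrict_of_ae ?_⟩
    filter_upwards [(ae_restrict_iff' hmeas).1 hM] with s hs
    by_cases hsE : (s, j) ∈ E
    · rw [cutoff_of_mem u hsE]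
      exact (hs hsE).trans (le_max_left _ _)
    · rw [cutoff_of_notMem u hsE, norm_zero]
      exact le_max_right _ _

/-- A hybrid time domain with finitely many jumps, with jump times `t 0 = 0, …, t J`. -/
structure IsFiniteDomain (E : Set (ℝ × ℕ)) (t : ℕ → ℝ) (J : ℕ) : Prop where
  zero : t 0 = 0
  mono : Monotone t
  slice : ∀ j < J, timeSlice E j = Icc (t j) (t (j + 1))
  empty : ∀ j, J < j → timeSlice E j = ∅

/-- Infinitely many jumps make j unbounded and an infinite last interval makes t unbounded, which
leaves two shapes. -/
theorem IsHybridTimeDomain.exists_finite_of_not_complete {E : Set (ℝ × ℕ)}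
    (hE : IsHybridTimeDomain E) (hc : ¬ IsCompleteDomain E) :
    ∃ t J, IsFiniteDomain E t J ∧ (timeSlice E J = Icc (t J) (t (J + 1)) ∨
      (t J < t (J + 1) ∧ timeSlice E J = Ico (t J) (t (J + 1)))) := by
  obtain ⟨t, h0, hm, h⟩ := hE
  have hpos : ∀ j, 0 ≤ t j := fun j => h0 ▸ hm (Nat.zero_le j)
  rcases h with h | ⟨J, h1, h2, h3⟩
  · refine absurd (fun M => ?_) hc
    obtain ⟨n, hn⟩ := exists_nat_gt M
    refine ⟨(t n, n), ?_, ?_⟩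
    · have : t n ∈ timeSlice E n := by rw [h]; exact ⟨le_rfl, hm (Nat.le_succ n)⟩
      exact this
    · have := hpos n
      dsimp only
      linarith
  · refine ⟨t, J, ⟨h0, hm, h1, h3⟩, ?_⟩
    rcases h2 with h2 | h2 | h2
    · exact Or.inl h2
    · exact Or.inr h2
    · refine absurd (fun M => ?_) hc
      refine ⟨(max (t J) (M + 1), J), ?_, ?_⟩
      · have : max (t J) (M + 1) ∈ timeSlice E J := by
          rw [h2]; exact mem_Ici.2 (le_max_left _ _)
        exact this
      · have : M + 1 ≤ max (t J) (M + 1) := le_max_right _ _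
        have hJ : (0 : ℝ) ≤ J := Nat.cast_nonneg J
        dsimp only
        linarith

theorem IsFiniteDomain.isHybridTimeDomain {E : Set (ℝ × ℕ)} {t : ℕ → ℝ} {J : ℕ}
    (h : IsFiniteDomain E t J) (hJ : timeSlice E J = Icc (t J) (t (J + 1))) :
    IsHybridTimeDomain E :=
  ⟨t, h.zero, h.mono, Or.inr ⟨J, h.slice, Or.inl hJ, h.empty⟩⟩

theorem IsFiniteDomain.le_of_mem {E : Set (ℝ × ℕ)} {t : ℕ → ℝ} {J : ℕ}
    (h : IsFiniteDomain E t J) {s : ℝ} {j : ℕ} (hs : (s, j) ∈ E) : j ≤ J := by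
  by_contra! hj
  have h1 : s ∈ timeSlice E j := hs
  rw [h.empty j hj] at h1
  exact h1

namespace IsSolutionPair

variable {X W Y : Type*} [NormedAddCommGroup X] [NormedSpace ℝ X]
    [NormedAddCommGroup W] [NormedAddCommGroup Y] {Sys : HybridSystem X W Y}
    {E : Set (ℝ × ℕ)} {φ : ℝ → ℕ → X} {w : ℝ → ℕ → W} {η : ℝ → ℕ → Y} {t : ℕ → ℝ} {J : ℕ}

/-- A solution pair whose last interval is compact extends by a jump. -/
theorem exists_jump_extension (h : IsSolutionPair Sys E φ w η) (hE : IsFiniteDomain E t J)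
    (hJ : timeSlice E J = Icc (t J) (t (J + 1))) (hjump : φ (t (J + 1)) J ∈ Sys.jumpSet)
    {g : X} (hg : g ∈ Sys.jump (φ (t (J + 1)) J) (η (t (J + 1)) J)) :
    ∃ E' φ', IsSolutionPair Sys E' φ' (cutoff E w) (cutoff E η) ∧ E ⊆ E' ∧
      (∀ t j, (t, j) ∈ E → φ' t j = φ t j) ∧ E' ≠ E := by
  obtain ⟨t₀, ht₀⟩ := h.timeDomain.exists_hasJumpTimes
  set T := t (J + 1) with hT
  have hTJ : (T, J) ∈ E := by
    have : T ∈ timeSlice E J := by rw [hJ]; exact ⟨hE.mono (Nat.le_succ J), le_rfl⟩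
    exact this
  have hne : ∀ {s j}, (s, j) ∈ E → j ≠ J + 1 := fun hs hj => by
    have := hE.le_of_mem hs
    omega
  let E' : Set (ℝ × ℕ) := E ∪ {(T, J + 1)}
  have hmem : ∀ s j, (s, j) ∈ E' ↔ (s, j) ∈ E ∨ (s = T ∧ j = J + 1) := by
    intro s j
    simp only [E', mem_union, mem_singleton_iff, Prod.mk.injEq]
  have hslice : ∀ j, j ≠ J + 1 → timeSlice E' j = timeSlice E j := fun j hj => by
    ext s
    change (s, j) ∈ E' ↔ (s, j) ∈ E
    rw [hmem]
    simp [hj]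
  have hlast : timeSlice E' (J + 1) = {T} := by
    ext s
    change (s, J + 1) ∈ E' ↔ s = T
    rw [hmem]
    simp only [and_true, or_iff_right_iff_imp]
    exact fun hs => absurd rfl (hne hs)
  -- Stopping the jump times at T makes the new last slice the degenerate interval [T, T].
  have hdom : IsFiniteDomain E' (fun j => t (min j (J + 1))) (J + 1) := by
    refine ⟨by simpa using hE.zero, fun a b hab => hE.mono (by omega), fun j hj => ?_,
      fun j hj => ?_⟩
    · rw [hslice j hj.ne, min_eq_left hj.le, min_eq_left (Nat.succ_le_of_lt hj)]
      rcases (Nat.lt_succ_iff.1 hj).eq_or_lt with rfl | hj'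
      · exact hJ
      · exact hE.slice j hj'
    · rw [hslice j hj.ne']
      exact hE.empty j (by omega)
  let φ' : ℝ → ℕ → X := fun s j => if j = J + 1 then g else φ s j
  have hφ : ∀ s j, j ≠ J + 1 → φ' s j = φ s j := fun s j hj => if_neg hj
  refine ⟨E', φ', ⟨hdom.isHybridTimeDomain (by rw [hlast]; simp [hT]), ?_, ?_, ?_, ?_, ?_, ?_⟩,
    subset_union_left, fun s j hs => hφ s j (hne hs), ?_⟩
  · intro j a ha b hb
    by_cases hj : j = J + 1
    · subst hj
      simp only [φ', if_true]
      exact LipschitzOnWith.absolutelyContinuousOnInterval (LipschitzWith.const g).lipschitzOnWith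
    · rw [hslice j hj] at ha hb
      simp only [hφ _ j hj]
      exact h.arc j a ha b hb
  · refine h.input_w.cutoff ht₀ fun j => ?_
    by_cases hj : j = J + 1
    · exact Or.inr ⟨0, by rw [hE.empty j (by omega)]; simp⟩
    · exact Or.inl (hslice j hj)
  · refine h.input_η.cutoff ht₀ fun j => ?_
    by_cases hj : j = J + 1
    · exact Or.inr ⟨0, by rw [hE.empty j (by omega)]; simp⟩
    · exact Or.inl (hslice j hj)
  · rw [hφ 0 0 (by omega)]
    exact h.initial
  · intro j
    by_cases hj : j = J + 1
    · subst hj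
      rw [hlast]
      simp
    · rw [hslice j hj]
      simp only [hφ _ j hj]
      filter_upwards [h.flows j,
        ae_restrict_mem (ht₀.ordConnected_timeSlice j).measurableSet] with s hs hsE
      rwa [cutoff_of_mem (E := E) w hsE]
  · rintro s j ⟨h1, h2⟩
    rw [hmem] at h1 h2
    have hj : j ≠ J + 1 := by
      rintro rfl
      rcases h2 with h2 | h2
      · have := hE.le_of_mem h2; omega
      · omega
    have h1' : (s, j) ∈ E := h1.resolve_right fun h => hj h.2
    rw [hφ s j hj, cutoff_of_mem η h1']
    rcases h2 with h2 | ⟨rfl, h2⟩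
    · rw [hφ s _ (hne h2)]
      exact h.jumps s j ⟨h1', h2⟩
    · obtain rfl : j = J := by omega
      simp only [φ', if_true]
      exact ⟨hjump, hg⟩
  · intro heq
    have : (T, J + 1) ∈ E := heq ▸ (hmem _ _).2 (Or.inr ⟨rfl, rfl⟩)
    exact hne this rfl

/-- A solution pair extends when its last interval can be enlarged to a compact one. -/
theorem exists_flow_extension (h : IsSolutionPair Sys E φ w η) (hE : IsFiniteDomain E t J)
    {T : ℝ} (htJ : (t J, J) ∈ E) (hsub : timeSlice E J ⊆ Icc (t J) T) (hT : (T, J) ∉ E)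
    {f : ℝ → X} (hf : AbsolutelyContinuousOnInterval f (t J) T)
    (hfφ : ∀ s, (s, J) ∈ E → f s = φ s J)
    (hflow : ∀ᵐ s ∂(volume.restrict (Icc (t J) T)), f s ∈ Sys.flowSet ∧
      HasDerivAt f (Sys.flow (f s) (cutoff E w s J)) s)
    (hw : ∃ M : ℝ, ∀ᵐ s ∂(volume.restrict (timeSlice E J)), ‖w s J‖ ≤ M)
    (hη : ∃ M : ℝ, ∀ᵐ s ∂(volume.restrict (timeSlice E J)), ‖η s J‖ ≤ M) :
    ∃ E' φ', IsSolutionPair Sys E' φ' (cutoff E w) (cutoff E η) ∧ E ⊆ E' ∧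
      (∀ t j, (t, j) ∈ E → φ' t j = φ t j) ∧ E' ≠ E := by
  obtain ⟨t₀, ht₀⟩ := h.timeDomain.exists_hasJumpTimes
  have htT : t J ≤ T := (hsub htJ).2
  let E' : Set (ℝ × ℕ) := E ∪ {p | p.1 ∈ Icc (t J) T ∧ p.2 = J}
  have hmem : ∀ s j, (s, j) ∈ E' ↔ (s, j) ∈ E ∨ (s ∈ Icc (t J) T ∧ j = J) := fun s j => Iff.rfl
  have hslice : ∀ j, j ≠ J → timeSlice E' j = timeSlice E j := fun j hj => by
    ext s
    change (s, j) ∈ E' ↔ (s, j) ∈ E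
    rw [hmem]
    simp [hj]
  have hlast : timeSlice E' J = Icc (t J) T := by
    ext s
    change (s, J) ∈ E' ↔ s ∈ Icc (t J) T
    rw [hmem]
    simp only [and_true, or_iff_right_iff_imp]
    exact fun hs => hsub hs
  have hdom : IsFiniteDomain E' (fun j => if j ≤ J then t j else T) J := by
    refine ⟨by simpa using hE.zero, fun a b hab => ?_, fun j hj => ?_, fun j hj => ?_⟩
    · split_ifs with h1 h2
      · exact hE.mono hab
      · exact (hE.mono h1).trans htT
      · omega
      · exact le_rfl
    · rw [hslice j hj.ne, if_pos hj.le, if_pos (Nat.succ_le_of_lt hj)]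
      exact hE.slice j hj
    · rw [hslice j hj.ne']
      exact hE.empty j hj
  let φ' : ℝ → ℕ → X := fun s j => if j = J then f s else φ s j
  have hφ : ∀ s j, j ≠ J → φ' s j = φ s j := fun s j hj => if_neg hj
  have hφJ : ∀ s, φ' s J = f s := fun s => if_pos rfl
  have hagree : ∀ s j, (s, j) ∈ E → φ' s j = φ s j := fun s j hs => by
    by_cases hj : j = J
    · subst hj
      rw [hφJ, hfφ s hs]
    · exact hφ s j hj
  refine ⟨E', φ', ⟨hdom.isHybridTimeDomain (by rw [hlast]; simp), ?_, ?_, ?_, ?_, ?_, ?_⟩,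
    subset_union_left, hagree, ?_⟩
  · intro j a ha b hb
    by_cases hj : j = J
    · subst hj
      rw [hlast] at ha hb
      simp only [hφJ]
      refine hf.mono ?_
      rw [uIcc_of_le htT]
      exact uIcc_subset_Icc ha hb
    · rw [hslice j hj] at ha hb
      simp only [hφ _ j hj]
      exact h.arc j a ha b hb
  · refine h.input_w.cutoff ht₀ fun j => ?_
    by_cases hj : j = J
    · exact Or.inr (hj ▸ hw)
    · exact Or.inl (hslice j hj)
  · refine h.input_η.cutoff ht₀ fun j => ?_
    by_cases hj : j = J
    · exact Or.inr (hj ▸ hη)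
    · exact Or.inl (hslice j hj)
  · rw [hagree 0 0 ht₀.origin]
    exact h.initial
  · intro j
    by_cases hj : j = J
    · subst hj
      rw [hlast]
      simpa only [hφJ] using hflow
    · rw [hslice j hj]
      simp only [hφ _ j hj]
      filter_upwards [h.flows j,
        ae_restrict_mem (ht₀.ordConnected_timeSlice j).measurableSet] with s hs hsE
      rwa [cutoff_of_mem (E := E) w hsE]
  · rintro s j ⟨h1, h2⟩
    rw [hmem] at h1 h2
    have hj : j < J := by
      rcases h2 with h2 | h2
      · have := hE.le_of_mem h2; omega
      · omega
    have h1' : (s, j) ∈ E := h1.resolve_right fun h => hj.ne h.2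
    -- No jump is created: slice j ends at t (j + 1), so if j + 1 = J an added point can only meet
    -- it at s = t J, already in E.
    have h2' : (s, j + 1) ∈ E := by
      rcases h2 with h2 | ⟨h2, h3⟩
      · exact h2
      · have h4 : s ∈ timeSlice E j := h1'
        rw [hE.slice j hj, h3] at h4
        rw [le_antisymm h4.2 h2.1, h3]
        exact htJ
    rw [hagree s j h1', hagree s _ h2', cutoff_of_mem η h1']
    exact h.jumps s j ⟨h1', h2'⟩
  · intro heq
    exact hT (heq ▸ (hmem _ _).2 (Or.inr ⟨⟨htT, le_rfl⟩, rfl⟩))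

end IsSolutionPair

/-! ## Lipschitz vector fields -/

theorem LipschitzWith.exists_norm_le {X Y : Type*} [NormedAddCommGroup X] [NormedAddCommGroup Y]
    {f : X → Y} {K : NNReal} (hf : LipschitzWith K f) :
    ∃ c > 0, ∀ x, ‖f x‖ ≤ c * (1 + ‖x‖) := by
  refine ⟨‖f 0‖ + K + 1, by positivity, fun x => ?_⟩
  have h1 := hf.dist_le_mul x 0
  rw [dist_eq_norm, dist_eq_norm, sub_zero] at h1
  have h2 : ‖f x‖ ≤ ‖f x - f 0‖ + ‖f 0‖ := norm_le_norm_sub_add _ _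
  have h3 : 0 ≤ ‖f 0‖ * ‖x‖ := by positivity
  have h4 : (0 : ℝ) ≤ K := K.coe_nonneg
  nlinarith [norm_nonneg x]

/-- Local solutions, forward in time, of an autonomous Lipschitz differential equation. -/
theorem LipschitzWith.exists_solution {X : Type*} [NormedAddCommGroup X] [NormedSpace ℝ X]
    [CompleteSpace X] {F : X → X} {K : NNReal} (hF : LipschitzWith K F) (T : ℝ) (x₀ : X) :
    ∃ h₀ > 0, ∀ h, 0 ≤ h → h ≤ h₀ → ∃ α : ℝ → X, α T = x₀ ∧
      (∃ C : NNReal, LipschitzOnWith C α (Icc T (T + h))) ∧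
      ∀ s ∈ Ioo T (T + h), HasDerivAt α (F (α s)) s := by
  -- L bounds ‖F‖ on the unit ball around x₀, so a solution cannot leave the ball within time 1/(L +
  -- 1).
  set L : NNReal := ‖F x₀‖₊ + K with hL
  have hLpos : (0 : ℝ) < L + 1 := by positivity
  refine ⟨1 / (L + 1), by positivity, fun h h0 hh => ?_⟩
  have hT : T ∈ Icc T (T + h) := ⟨le_rfl, by linarith⟩
  have hpl : IsPicardLindelof (fun _ => F) (⟨T, hT⟩ : Icc T (T + h)) x₀ 1 0 L K := by
    refine ⟨fun _ _ => hF.lipschitzOnWith, fun x _ => continuousOn_const, fun _ _ x hx => ?_, ?_⟩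
    · have h1 := hF.dist_le_mul x x₀
      rw [dist_eq_norm] at h1
      have h2 : dist x x₀ ≤ 1 := by simpa using hx
      have h3 : ‖F x‖ ≤ ‖F x - F x₀‖ + ‖F x₀‖ := norm_le_norm_sub_add _ _
      have h4 : (K : ℝ) * dist x x₀ ≤ K * 1 := by gcongr
      rw [hL]
      push_cast
      linarith
    · rw [le_div_iff₀ hLpos] at hh
      simp only [add_sub_cancel_left, sub_self, max_eq_left h0]
      push_cast
      nlinarith
  obtain ⟨α, hα0, hα⟩ := hpl.exists_eq_forall_mem_Icc_hasDerivWithinAt₀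
  refine ⟨α, hα0, ?_, fun s hs =>
    (hα s (Ioo_subset_Icc_self hs)).hasDerivAt (Icc_mem_nhds hs.1 hs.2)⟩
  have hcont : ContinuousOn α (Icc T (T + h)) := fun s hs => (hα s hs).continuousWithinAt
  obtain ⟨C, hC⟩ := isCompact_Icc.exists_bound_of_continuousOn
    (hF.continuous.comp_continuousOn hcont)
  refine ⟨C.toNNReal, (convex_Icc _ _).lipschitzOnWith_of_nnnorm_hasDerivWithin_le hα
    fun s hs => ?_⟩
  rw [← NNReal.coe_le_coe, coe_nnnorm]
  exact (hC s hs).trans (Real.le_coe_toNNReal C)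

/-- Linear growth prevents escape in finite time. -/
theorem lipschitzOnWith_of_linear_growth {X : Type*} [NormedAddCommGroup X]
    [InnerProductSpace ℝ X] {f f' : ℝ → X} {a T c : ℝ} (hc : 0 < c)
    (hf : ∀ r s, a ≤ r → r ≤ s → s < T → AbsolutelyContinuousOnInterval f r s)
    (h : ∀ᵐ s ∂(volume.restrict (Ico a T)), HasDerivAt f (f' s) s ∧ ‖f' s‖ ≤ c * (1 + ‖f s‖)) :
    ∃ C : NNReal, LipschitzOnWith C f (Ico a T) := by
  have hbound : ∀ s ∈ Ico a T,
      1 + ‖f s‖ ^ 2 ≤ Real.exp (4 * c * (T - a)) * (1 + ‖f a‖ ^ 2) := by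
    intro s hs
    have hL : LocallyLipschitz fun x : X => 1 + ‖x‖ ^ 2 :=
      ContDiff.locallyLipschitz (𝕂 := ℝ) (contDiff_const.add (contDiff_norm_sq ℝ))
    -- The derivative of 1 + ‖f‖² is at most 2c‖f‖(1 + ‖f‖) ≤ 4c(1 + ‖f‖²).
    have key := ((hf a s le_rfl hs.1 hs.2).comp_locallyLipschitz hL).le_exp_mul_add hs.1
      (c := -(4 * c)) (g := 0) (f' := fun x => 2 * inner ℝ (f x) (f' x)) (by
        filter_upwards [ae_restrict_of_ae_restrict_of_subset
          (Icc_subset_Ico_right hs.2) h] with x hx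
        refine ⟨(hx.1.norm_sq).const_add 1, ?_⟩
        have h1 := real_inner_le_norm (f x) (f' x)
        have h2 := mul_le_mul_of_nonneg_left hx.2 (norm_nonneg (f x))
        nlinarith [mul_nonneg hc.le (sq_nonneg (1 - ‖f x‖)), mul_nonneg hc.le (sq_nonneg ‖f x‖),
          norm_nonneg (f x)])
    simp only [neg_neg, sub_zero, add_zero] at key
    refine key.trans ?_
    gcongr
    exact hs.2.le
  set R := Real.exp (4 * c * (T - a)) * (1 + ‖f a‖ ^ 2) with hR
  have hR0 : 0 < R := by positivity
  refine ⟨(c * (1 + R)).toNNReal, LipschitzOnWith.of_dist_le' ?_⟩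
  have hle : ∀ r ∈ Ico a T, ∀ s ∈ Ico a T, r ≤ s → dist (f s) (f r) ≤ c * (1 + R) * dist s r := by
    intro r hr s hs hrs
    rw [dist_eq_norm, Real.dist_eq, abs_of_nonneg (sub_nonneg.2 hrs)]
    refine (hf r s hr.1 hrs hs.2).norm_sub_le hrs (f' := f') ?_
    have hsub : Icc r s ⊆ Ico a T := fun x hx => ⟨hr.1.trans hx.1, hx.2.trans_lt hs.2⟩
    filter_upwards [ae_restrict_of_ae_restrict_of_subset hsub h,
      ae_restrict_mem measurableSet_Icc] with x hx hxm
    refine ⟨hx.1, hx.2.trans ?_⟩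
    have := hbound x (hsub hxm)
    gcongr
    nlinarith [sq_nonneg (‖f x‖ - 1)]
  intro r hr s hs
  rcases le_total r s with hrs | hrs
  · rw [dist_comm, dist_comm r]
    exact hle r hr s hs hrs
  · exact hle s hs r hr hrs

namespace Plant

variable {nz ny nw nq ns np : ℕ}

theorem exists_lipschitz_mulVec {A m n : Type*} [PseudoMetricSpace A] [Fintype m] [Fintype n]
    (M : Matrix m n ℝ) {g : A → n → ℝ} (hg : ∃ K, LipschitzWith K g) :
    ∃ K, LipschitzWith K fun x => M *ᵥ g x :=
  hg.imp' _ fun _ h => (LinearMap.toContinuousLinearMap (Matrix.mulVecLin M)).lipschitz.comp h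

theorem exists_lipschitz_add {A B : Type*} [PseudoMetricSpace A] [NormedAddCommGroup B]
    {f g : A → B} (hf : ∃ K, LipschitzWith K f) (hg : ∃ K, LipschitzWith K g) :
    ∃ K, LipschitzWith K fun x => f x + g x := by
  obtain ⟨K, hK⟩ := hf
  obtain ⟨K', hK'⟩ := hg
  exact ⟨_, hK.add hK'⟩

theorem exists_lipschitz_sub {A B : Type*} [PseudoMetricSpace A] [NormedAddCommGroup B]
    {f g : A → B} (hf : ∃ K, LipschitzWith K f) (hg : ∃ K, LipschitzWith K g) :
    ∃ K, LipschitzWith K fun x => f x - g x := by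
  obtain ⟨K, hK⟩ := hf
  obtain ⟨K', hK'⟩ := hg
  exact ⟨_, hK.sub hK'⟩

theorem exists_lipschitz_linear {A B : Type*} [NormedAddCommGroup A] [NormedSpace ℝ A]
    [FiniteDimensional ℝ A] [NormedAddCommGroup B] [NormedSpace ℝ B] (f : A →ₗ[ℝ] B) :
    ∃ K, LipschitzWith K f :=
  ⟨_, (LinearMap.toContinuousLinearMap f).lipschitz⟩

theorem exists_lipschitz_nonlin {P : Plant nz ny nw nq ns np} {ℓ : ℝ}
    (hψ : ∀ v₁ v₂, ‖P.ψ v₁ - P.ψ v₂‖ ≤ ℓ * ‖v₁ - v₂‖) {A : Type*} [PseudoMetricSpace A]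
    {g : A → Fin nz → ℝ} (hg : ∃ K, LipschitzWith K g) :
    ∃ K, LipschitzWith K fun x => P.nonlin (g x) := by
  have hψ' : LipschitzWith ℓ.toNNReal P.ψ := LipschitzWith.of_dist_le' fun x y => by
    simpa [dist_eq_norm] using hψ x y
  obtain ⟨K₁, h₁⟩ := exists_lipschitz_linear
    (WithLp.linearEquiv 2 ℝ (Fin nq → ℝ)).symm.toLinearMap
  obtain ⟨K₂, h₂⟩ := exists_lipschitz_linear
    (WithLp.linearEquiv 2 ℝ (Fin ns → ℝ)).toLinearMap
  obtain ⟨K₃, h₃⟩ := exists_lipschitz_mulVec P.S hg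
  exact ⟨_, h₂.comp (hψ'.comp (h₁.comp h₃))⟩

/-- Joint dependence on state and w serves twice: local existence with w = 0, and linear growth in x
when w is bounded. -/
theorem exists_lipschitz_flow {P : Plant nz ny nw nq ns np} {ℓ : ℝ}
    (hψ : ∀ v₁ v₂, ‖P.ψ v₁ - P.ψ v₂‖ ≤ ℓ * ‖v₁ - v₂‖) (L : Matrix (Fin nz) (Fin ny) ℝ)
    (H : Matrix (Fin ny) (Fin ny) ℝ) (T₁ T₂ : ℝ) :
    ∃ K, LipschitzWith K fun p : HState nz ny × Vec nw =>
      (P.errorSystem L H T₁ T₂).flow p.1 p.2 := by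
  have hz : ∃ K, LipschitzWith K fun p : HState nz ny × Vec nw => p.1.z :=
    exists_lipschitz_linear (A := HState nz ny × Vec nw)
      { toFun := fun p => p.1.z, map_add' := fun _ _ => rfl, map_smul' := fun _ _ => rfl }
  have he : ∃ K, LipschitzWith K fun p : HState nz ny × Vec nw => p.1.err :=
    exists_lipschitz_linear (A := HState nz ny × Vec nw)
      { toFun := fun p => p.1.err, map_add' := fun _ _ => rfl, map_smul' := fun _ _ => rfl }
  have hε : ∃ K, LipschitzWith K fun p : HState nz ny × Vec nw => p.1.ε :=
    exists_lipschitz_linear (A := HState nz ny × Vec nw)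
      { toFun := fun p => p.1.ε, map_add' := fun _ _ => rfl, map_smul' := fun _ _ => rfl }
  have hw : ∃ K, LipschitzWith K fun p : HState nz ny × Vec nw => p.2.ofLp :=
    exists_lipschitz_linear (A := HState nz ny × Vec nw)
      { toFun := fun p => p.2.ofLp, map_add' := fun _ _ => rfl, map_smul' := fun _ _ => rfl }
  obtain ⟨K₁, h₁⟩ : ∃ K, LipschitzWith K fun p : HState nz ny × Vec nw =>
      P.plantField p.1.z p.2.ofLp :=
    exists_lipschitz_add (exists_lipschitz_add (exists_lipschitz_mulVec P.A hz)
      (exists_lipschitz_mulVec P.B (exists_lipschitz_nonlin hψ hz)))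
      (exists_lipschitz_mulVec P.N hw)
  obtain ⟨K₂, h₂⟩ : ∃ K, LipschitzWith K fun p : HState nz ny × Vec nw =>
      P.calF L H *ᵥ p.1.err + P.calQ *ᵥ P.zeta p.1.z p.1.ε + P.calT *ᵥ p.2.ofLp :=
    exists_lipschitz_add (exists_lipschitz_add (exists_lipschitz_mulVec (P.calF L H) he)
      (exists_lipschitz_mulVec P.calQ (exists_lipschitz_sub (exists_lipschitz_nonlin hψ hz)
        (exists_lipschitz_nonlin hψ (exists_lipschitz_sub hz hε)))))
      (exists_lipschitz_mulVec P.calT hw)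
  obtain ⟨K₃, h₃⟩ := exists_lipschitz_linear
    (WithLp.linearEquiv 2 ℝ (Fin nz ⊕ ((Fin nz ⊕ Fin ny) ⊕ Unit) → ℝ)).symm.toLinearMap
  refine ⟨K₃ * max K₁ K₂, h₃.comp (g := _) (LipschitzWith.of_dist_le_mul fun p q => ?_)⟩
  refine (dist_pi_le_iff (by positivity)).2 fun i => ?_
  have e₁ : (K₁ : ℝ) * dist p q ≤ (max K₁ K₂ : NNReal) * dist p q := by
    gcongr; exact le_max_left _ _
  have e₂ : (K₂ : ℝ) * dist p q ≤ (max K₁ K₂ : NNReal) * dist p q := by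
    gcongr; exact le_max_right _ _
  rcases i with i | i | i
  · exact ((dist_le_pi_dist _ _ i).trans (h₁.dist_le_mul p q)).trans e₁
  · exact ((dist_le_pi_dist _ _ i).trans (h₂.dist_le_mul p q)).trans e₂
  · simp only [Sum.elim_inr, dist_self]
    positivity

end Plant

namespace Plant

variable {nz ny nw nq ns np : ℕ}

/-! ## Completeness of maximal solution pairs -/

section Completeness

variable {P : Plant nz ny nw nq ns np} {ℓ T₁ T₂ : ℝ} {L : Matrix (Fin nz) (Fin ny) ℝ}
  {H : Matrix (Fin ny) (Fin ny) ℝ} {E : Set (ℝ × ℕ)}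
  {φ : ℝ → ℕ → HState nz ny} {w : ℝ → ℕ → Vec nw} {η : ℝ → ℕ → Vec ny} {t : ℕ → ℝ} {J : ℕ}

theorem exists_flow_solution (hψ : ∀ v₁ v₂, ‖P.ψ v₁ - P.ψ v₂‖ ≤ ℓ * ‖v₁ - v₂‖)
    (L : Matrix (Fin nz) (Fin ny) ℝ) (H : Matrix (Fin ny) (Fin ny) ℝ) (T₁ T : ℝ)
    {x₀ : HState nz ny} (hx₀ : x₀.τ ∈ Ioc 0 T₂) :
    ∃ d > 0, ∃ α : ℝ → HState nz ny, α T = x₀ ∧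
      (∃ C : NNReal, LipschitzOnWith C α (Icc T (T + d))) ∧
      ∀ s ∈ Ioo T (T + d), α s ∈ (P.errorSystem L H T₁ T₂).flowSet ∧
        HasDerivAt α ((P.errorSystem L H T₁ T₂).flow (α s) 0) s := by
  obtain ⟨K, hK⟩ := exists_lipschitz_flow hψ L H T₁ T₂
  have hF : LipschitzWith (K * 1) fun x => (P.errorSystem L H T₁ T₂).flow x 0 := by
    have := hK.comp (LipschitzWith.prodMk_right (α := HState nz ny) (0 : Vec nw))
    exact this
  obtain ⟨h₀, h₀pos, hsol⟩ := hF.exists_solution T x₀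
  -- The duration is capped by the timer, which keeps the solution in the flow set.
  obtain ⟨α, hα0, ⟨C, hC⟩, hα⟩ := hsol (min h₀ x₀.τ) (le_min h₀pos.le hx₀.1.le) (min_le_left _ _)
  refine ⟨min h₀ x₀.τ, lt_min h₀pos hx₀.1, α, hα0, ⟨C, hC⟩, fun s hs => ⟨?_, hα s hs⟩⟩
  have hac : AbsolutelyContinuousOnInterval α T s :=
    LipschitzOnWith.absolutelyContinuousOnInterval (by
      rw [uIcc_of_le hs.1.le]
      exact hC.mono (Icc_subset_Icc_right hs.2.le))
  have hτ := τ_eq_of_ae_hasDerivAt hs.1.le hac (by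
    rw [← restrict_Ioo_eq_restrict_Icc]
    filter_upwards [ae_restrict_mem measurableSet_Ioo] with x hx
    exact HState.hasDerivAt_apply (hα x ⟨hx.1, hx.2.trans hs.2⟩) _)
  have hle : min h₀ x₀.τ ≤ x₀.τ := min_le_right _ _
  rw [hα0] at hτ
  change (α s).τ ∈ Icc 0 T₂
  rw [hτ]
  exact ⟨by linarith [hs.2], by linarith [hs.1, hx₀.2]⟩

theorem exists_extension_of_Icc (hT₁ : 0 < T₁) (hT₁₂ : T₁ ≤ T₂)
    (hψ : ∀ v₁ v₂, ‖P.ψ v₁ - P.ψ v₂‖ ≤ ℓ * ‖v₁ - v₂‖)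
    (h : IsSolutionPair (P.errorSystem L H T₁ T₂) E φ w η) (hE : IsFiniteDomain E t J)
    (hJ : timeSlice E J = Icc (t J) (t (J + 1))) :
    ∃ E' φ', IsSolutionPair (P.errorSystem L H T₁ T₂) E' φ' (cutoff E w) (cutoff E η) ∧ E ⊆ E' ∧
      (∀ t j, (t, j) ∈ E → φ' t j = φ t j) ∧ E' ≠ E := by
  obtain ⟨t₀, ht₀⟩ := h.timeDomain.exists_hasJumpTimes
  set T := t (J + 1) with hT
  have htT : t J ≤ T := hE.mono (Nat.le_succ J)
  have hmem : ∀ s, (s, J) ∈ E ↔ s ∈ Icc (t J) T := fun s => by rw [← hJ]; rfl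
  have hTJ : (T, J) ∈ E := (hmem T).2 ⟨htT, le_rfl⟩
  have htJ : (t J, J) ∈ E := (hmem _).2 ⟨le_rfl, htT⟩
  have hτ := timer_mem hT₁ hT₁₂ h ht₀ hTJ
  rcases hτ.1.eq_or_lt with hτ0 | hτ0
  -- With an expired timer the solution jumps, here with reset value T₁; otherwise it flows on with
  -- w = 0.
  · exact h.exists_jump_extension hE hJ hτ0.symm ⟨T₁, ⟨le_rfl, hT₁₂⟩, rfl⟩
  obtain ⟨d, hdpos, α, hα0, ⟨C, hC⟩, hα⟩ := exists_flow_solution hψ L H T₁ T ⟨hτ0, hτ.2⟩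
  have hbound : ∀ {V : Type} [NormedAddCommGroup V] {u : ℝ → ℕ → V}, IsHybridInput E u →
      ∃ M : ℝ, ∀ᵐ s ∂(volume.restrict (timeSlice E J)), ‖u s J‖ ≤ M := fun hu => by
    have := (hu J).2 _ isCompact_Icc hJ.ge
    rwa [hJ]
  refine h.exists_flow_extension hE (T := T + d) htJ
    (hJ.trans_subset (Icc_subset_Icc_right (by linarith)))
    (fun hmem' => ?_) (f := fun s => if s ≤ T then φ s J else α s) ?_
    (fun s hs => if_pos ((hmem s).1 hs).2) ?_ (hbound h.input_w) (hbound h.input_η)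
  · have := ((hmem _).1 hmem').2
    linarith
  · exact (h.arc J _ htJ _ hTJ).concat htT (by linarith) hC hα0.symm
  · have hne : ∀ c : ℝ, ∀ᵐ s : ℝ, s ≠ c := fun c => by simp [ae_iff, measure_singleton]
    have hfl := (ae_restrict_iff' (ht₀.ordConnected_timeSlice J).measurableSet).1 (h.flows J)
    rw [ae_restrict_iff' measurableSet_Icc]
    filter_upwards [hfl, hne T, hne (T + d)] with s hs hsT hsd hsI
    rcases lt_or_gt_of_ne hsT with hlt | hgt
    · have hsE : (s, J) ∈ E := (hmem s).2 ⟨hsI.1, hlt.le⟩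
      obtain ⟨h1, h2⟩ := hs hsE
      rw [if_pos hlt.le, cutoff_of_mem w hsE]
      refine ⟨h1, h2.congr_of_eventuallyEq ?_⟩
      filter_upwards [Iio_mem_nhds hlt] with x hx
      exact if_pos (le_of_lt hx)
    · have hsE : (s, J) ∉ E := fun hsE => absurd ((hmem s).1 hsE).2 (not_le.2 hgt)
      rw [if_neg (not_le.2 hgt), cutoff_of_notMem w hsE]
      obtain ⟨h1, h2⟩ := hα s ⟨hgt, lt_of_le_of_ne hsI.2 hsd⟩
      refine ⟨h1, h2.congr_of_eventuallyEq ?_⟩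
      filter_upwards [Ioi_mem_nhds hgt] with x hx
      exact if_neg (not_le.2 hx)

/-- With w bounded up to the open end, linear growth makes the arc Lipschitz, hence extendable to
the endpoint. Local boundedness of w alone would not exclude blow-up there. -/
theorem exists_extension_of_Ico (hψ : ∀ v₁ v₂, ‖P.ψ v₁ - P.ψ v₂‖ ≤ ℓ * ‖v₁ - v₂‖)
    (h : IsSolutionPair (P.errorSystem L H T₁ T₂) E φ w η) (hE : IsFiniteDomain E t J)
    (hlt : t J < t (J + 1)) (hJ : timeSlice E J = Ico (t J) (t (J + 1)))
    (hw : ∃ M : ℝ, ∀ᵐ s ∂(volume.restrict (timeSlice E J)), ‖w s J‖ ≤ M)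
    (hη : ∃ M : ℝ, ∀ᵐ s ∂(volume.restrict (timeSlice E J)), ‖η s J‖ ≤ M) :
    ∃ E' φ', IsSolutionPair (P.errorSystem L H T₁ T₂) E' φ' (cutoff E w) (cutoff E η) ∧ E ⊆ E' ∧
      (∀ t j, (t, j) ∈ E → φ' t j = φ t j) ∧ E' ≠ E := by
  set T := t (J + 1) with hT
  have hmem : ∀ s, (s, J) ∈ E ↔ s ∈ Ico (t J) T := fun s => by rw [← hJ]; rfl
  have htJ : (t J, J) ∈ E := (hmem _).2 ⟨le_rfl, hlt⟩
  obtain ⟨M, hM⟩ := hw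
  obtain ⟨K, hK⟩ := exists_lipschitz_flow hψ L H T₁ T₂
  obtain ⟨c, hc, hgrowth⟩ := hK.exists_norm_le
  have hfl := h.flows J
  rw [hJ] at hfl hM
  obtain ⟨C, hC⟩ := lipschitzOnWith_of_linear_growth (f := fun s => φ s J) (a := t J) (T := T)
    (f' := fun s => (P.errorSystem L H T₁ T₂).flow (φ s J) (w s J))
    (c := c * (1 + |M|)) (by positivity)
    (fun r s hr hrs hs => h.arc J r ((hmem r).2 ⟨hr, hrs.trans_lt hs⟩) s
      ((hmem s).2 ⟨hr.trans hrs, hs⟩)) (by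
      filter_upwards [hfl, hM] with s hs hsM
      refine ⟨hs.2, (hgrowth (φ s J, w s J)).trans ?_⟩
      rw [mul_assoc]
      gcongr
      have h1 : ‖(φ s J, w s J)‖ ≤ ‖φ s J‖ + |M| :=
        max_le (le_add_of_nonneg_right (abs_nonneg M))
          ((hsM.trans (le_abs_self M)).trans (le_add_of_nonneg_left (norm_nonneg _)))
      nlinarith [mul_nonneg (abs_nonneg M) (norm_nonneg (φ s J))])
  obtain ⟨g, hg, hgφ⟩ := hC.extend_finite_dimension
  refine h.exists_flow_extension hE (T := T) htJ (hJ.trans_subset Ico_subset_Icc_self)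
    (fun hmem' => lt_irrefl _ ((hmem _).1 hmem').2) (f := g)
    (LipschitzOnWith.absolutelyContinuousOnInterval hg.lipschitzOnWith)
    (fun s hs => (hgφ ((hmem s).1 hs)).symm) ?_ ⟨M, by rwa [hJ]⟩ hη
  rw [← restrict_Ioo_eq_restrict_Icc]
  filter_upwards [ae_restrict_of_ae_restrict_of_subset Ioo_subset_Ico_self hfl,
    ae_restrict_mem measurableSet_Ioo] with s hs hsI
  have hsE : (s, J) ∈ E := (hmem s).2 (Ioo_subset_Ico_self hsI)
  rw [cutoff_of_mem w hsE, ← hgφ (Ioo_subset_Ico_self hsI)]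
  refine ⟨hs.1, hs.2.congr_of_eventuallyEq ?_⟩
  filter_upwards [Ioo_mem_nhds hsI.1 hsI.2] with x hx
  exact (hgφ (Ioo_subset_Ico_self hx)).symm

theorem exists_extension (hT₁ : 0 < T₁) (hT₁₂ : T₁ ≤ T₂)
    (hψ : ∀ v₁ v₂, ‖P.ψ v₁ - P.ψ v₂‖ ≤ ℓ * ‖v₁ - v₂‖)
    (h : IsSolutionPair (P.errorSystem L H T₁ T₂) E φ w η) (hE : ¬ IsCompleteDomain E)
    (hw : ∀ j, ∃ M : ℝ, ∀ᵐ s ∂(volume.restrict (timeSlice E j)), ‖w s j‖ ≤ M)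
    (hη : ∀ j, ∃ M : ℝ, ∀ᵐ s ∂(volume.restrict (timeSlice E j)), ‖η s j‖ ≤ M) :
    ∃ E' φ', IsSolutionPair (P.errorSystem L H T₁ T₂) E' φ' (cutoff E w) (cutoff E η) ∧ E ⊆ E' ∧
      (∀ t j, (t, j) ∈ E → φ' t j = φ t j) ∧ E' ≠ E := by
  obtain ⟨t, J, hfin, hJ | ⟨hlt, hJ⟩⟩ := h.timeDomain.exists_finite_of_not_complete hE
  · exact exists_extension_of_Icc hT₁ hT₁₂ hψ h hfin hJ
  · exact exists_extension_of_Ico hψ h hfin hlt hJ (hw J) (hη J)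

end Completeness

/-! ## The three properties of the observer -/

section Properties

variable {P : Plant nz ny nw nq ns np} {ℓ T₁ T₂ lam γ δ χ : ℝ}
  {P₁ X : Matrix (Fin nz) (Fin nz) ℝ} {P₂ U W : Matrix (Fin ny) (Fin ny) ℝ}
  {J : Matrix (Fin nz) (Fin ny) ℝ}

theorem isGESWithRate (hT₁ : 0 < T₁) (hT₁₂ : T₁ ≤ T₂) (hlam : 0 < lam) (hγ : 0 < γ)
    (hψ : ∀ v₁ v₂, ‖P.ψ v₁ - P.ψ v₂‖ ≤ ℓ * ‖v₁ - v₂‖)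
    (hP₁ : P₁.PosDef) (hP₂ : P₂.PosDef) (hδ : 0 < δ) (hχ : 0 < χ)
    (hLMI : P.DesignLMI ℓ T₂ lam γ δ χ P₁ X P₂ U W J) :
    IsGESWithRate (P.errorSystem (Xᵀ⁻¹ * J) (Uᵀ⁻¹ * W) T₁ T₂) (attractor nz ny T₂) lam := by
  obtain ⟨κ, hκ, D, -, rate, hrate, hbound⟩ :=
    exists_infDist_le hT₁ hT₁₂ hlam hγ hψ hP₁ hP₂ hδ hχ hLMI
  refine ⟨⟨κ, hκ, rate, hrate, fun E φ w η h hw hη s j hs => ?_⟩, fun E φ h => ?_⟩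
  · obtain ⟨t, hE⟩ := h.timeDomain.exists_hasJumpTimes
    have := hbound E φ w η h 0 le_rfl (fun i => by
        filter_upwards [ae_restrict_mem (hE.ordConnected_timeSlice i).measurableSet] with x hx
        rw [hw x i hx, norm_zero])
      (fun x i hx => by rw [hη x i hx.1, norm_zero]) s j hs
    simpa only [mul_zero, add_zero] using this
  · by_contra hc
    obtain ⟨E', φ', h', hsub, hagree, hne⟩ := exists_extension hT₁ hT₁₂ hψ h.1 hc
      (fun j => ⟨0, by simp⟩) (fun j => ⟨0, by simp⟩)
    -- The extension has zero input again, so it competes within the class in which maximality is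
    -- defined.
    rw [cutoff_zero, cutoff_zero] at h'
    exact hne (h.2 E' φ' h' hsub hagree)

theorem isEISS (hT₁ : 0 < T₁) (hT₁₂ : T₁ ≤ T₂) (hlam : 0 < lam) (hγ : 0 < γ)
    (hψ : ∀ v₁ v₂, ‖P.ψ v₁ - P.ψ v₂‖ ≤ ℓ * ‖v₁ - v₂‖)
    (hP₁ : P₁.PosDef) (hP₂ : P₂.PosDef) (hδ : 0 < δ) (hχ : 0 < χ)
    (hLMI : P.DesignLMI ℓ T₂ lam γ δ χ P₁ X P₂ U W J) :
    IsEISS (P.errorSystem (Xᵀ⁻¹ * J) (Uᵀ⁻¹ * W) T₁ T₂) (attractor nz ny T₂) := by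
  obtain ⟨κ, hκ, D, hD, rate, hrate, hbound⟩ :=
    exists_infDist_le hT₁ hT₁₂ hlam hγ hψ hP₁ hP₂ hδ hχ hLMI
  -- The factors 2 turn a sum into a maximum: a + b ≤ max (2a) (2b).
  refine ⟨⟨2 * κ, by positivity, rate, hrate, fun s => 2 * (D * s), ⟨by fun_prop, ?_, by simp⟩,
    fun E φ w η h hu s j hs => ?_⟩, fun E φ w η h hu => ?_⟩
  · intro a _ b _ hab
    dsimp only
    gcongr
  · obtain ⟨t, hE⟩ := h.timeDomain.exists_hasJumpTimes
    have h1 := (hbound E φ w η h _ ENNReal.toReal_nonneg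
      (fun i => (ae_norm_le_of_linfNorm hE hu i).mono fun x hx =>
        (norm_fst_le_pairInput w η x i).trans hx)
      (fun x i hx => (norm_snd_le_pairInput w η x i).trans (norm_le_of_linfNorm hu hx)) s j hs).2
    rcases le_total (κ * Real.exp (-rate * (s + j)) *
      Metric.infDist (φ 0 0) (attractor nz ny T₂))
      (D * (linfNorm E (pairInput w η)).toReal) with h2 | h2
    · exact le_max_of_le_right (by linarith)
    · exact le_max_of_le_left (by linarith)
  · obtain ⟨t, hE⟩ := h.1.timeDomain.exists_hasJumpTimes
    by_contra hc
    obtain ⟨E', φ', h', hsub, hagree, hne⟩ := exists_extension hT₁ hT₁₂ hψ h.1 hc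
      (fun j => ⟨_, (ae_norm_le_of_linfNorm hE hu j).mono fun x hx =>
        (norm_fst_le_pairInput w η x j).trans hx⟩)
      (fun j => ⟨_, (ae_norm_le_of_linfNorm hE hu j).mono fun x hx =>
        (norm_snd_le_pairInput w η x j).trans hx⟩)
    exact hne (h.2 E' φ' _ _ h' hsub fun s j hs =>
      ⟨hagree s j hs, cutoff_of_mem w hs, cutoff_of_mem η hs⟩)

end Properties

end Plant

theorem proposition3 {nz ny nw nq ns np : ℕ} (P : Plant nz ny nw nq ns np)
    (ℓ T₁ T₂ lam γ : ℝ) (hℓ : 0 < ℓ) (hT₁ : 0 < T₁) (hT₁₂ : T₁ ≤ T₂) (hlam : 0 < lam) (hγ : 0 < γ)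
    (hψ : ∀ v₁ v₂, ‖P.ψ v₁ - P.ψ v₂‖ ≤ ℓ * ‖v₁ - v₂‖)
    (P₁ X : Matrix (Fin nz) (Fin nz) ℝ) (P₂ U W : Matrix (Fin ny) (Fin ny) ℝ)
    (J : Matrix (Fin nz) (Fin ny) ℝ) (δ χ : ℝ) (hP₁ : P₁.PosDef) (hP₂ : P₂.PosDef)
    (hδ : 0 < δ) (hχ : 0 < χ) (hLMI : P.DesignLMI ℓ T₂ lam γ δ χ P₁ X P₂ U W J) :
    IsUnit X ∧ IsUnit U ∧ P.ObserverSolves T₁ T₂ lam γ (Xᵀ⁻¹ * J) (Uᵀ⁻¹ * W) :=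
  ⟨hLMI.isUnit.1, hLMI.isUnit.2,
    Plant.isGESWithRate hT₁ hT₁₂ hlam hγ hψ hP₁ hP₂ hδ hχ hLMI,
    Plant.isEISS hT₁ hT₁₂ hlam hγ hψ hP₁ hP₂ hδ hχ hLMI,
    Plant.hasL2Gain hT₁ hT₁₂ hlam hγ hψ hP₁ hP₂ hδ hχ hLMI⟩
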